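/- Let $h$ denote the absolute logarithmic Weil height on $\overline{\mathbb{Q}}$ and on $\mathbb{P}^1(\overline{\mathbb{Q}})=\overline{\mathbb{Q}}\cup\{\infty\}$ (with $h(\infty)=0$). Let $\lambda_0,\lambda_\infty\in\overline{\mathbb{Q}}$ with $\lambda_0\neq 0$ and $\lambda_0\lambda_\infty\neq 1$, so that $$f(z)=\frac{\lambda_0 z+z^2}{\lambda_\infty z+1}$$ is an endomorphism of $\mathbb{P}^1$ of degree $2$, and let $\hat h_f(P)=\lim_{n\to\infty}2^{-n}h(f^n(P))$ be its canonical height (the limit exists). Then the critical points $\zeta_1,\zeta_2\in\mathbb{P}^1(\overline{\mathbb{Q}})$ of $f$ satisfy $$\min\{\hat h_f(\zeta_1),\hat h_f(\zeta_2)\}\;\geq\;\frac{1}{32}h(\lambda_\infty)-\frac{25}{32}h(\lambda_0)-\frac{47}{32}\log 2-\frac{3}{16}\log 3 .$$ -/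

import Mathlib

open scoped LinearAlgebra.Projectivization

namespace QuadraticMorphism

/-- The projective line over `F`; `[z : 1]` is the affine point `z` and `[1 : 0]` is `∞`. -/
abbrev P1 (F : Type*) [Field F] : Type _ := ℙ F (Fin 2 → F)

/-- An endomorphism of degree `d` of the projective line over an algebraically closed field:
a pair of binary forms of degree `d` without a common nontrivial zero. -/
structure Endo (F : Type*) [Field F] [IsAlgClosed F] (d : ℕ) where
  form : Fin 2 → MvPolynomial (Fin 2) F
  homogeneous : ∀ i, (form i).IsHomogeneous d
  no_common_zero : ∀ x : Fin 2 → F, x ≠ 0 → (fun i => MvPolynomial.eval x (form i)) ≠ 0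

theorem eval_smul_of_isHomogeneous {F : Type*} [Field F] {d : ℕ}
    {p : MvPolynomial (Fin 2) F} (hp : p.IsHomogeneous d) (t : F) (x : Fin 2 → F) :
    MvPolynomial.eval (t • x) p = t ^ d * MvPolynomial.eval x p := by
  rw [MvPolynomial.eval_eq, MvPolynomial.eval_eq, Finset.mul_sum]
  refine Finset.sum_congr rfl fun m hm => ?_
  have h1 : ∑ i ∈ m.support, m i = d := by
    have := hp (MvPolynomial.mem_support_iff.mp hm)
    rwa [Finsupp.weight_apply, Finsupp.sum, Finset.sum_congr rfl
      (fun i _ => show m i • (1 : Fin 2 → ℕ) i = m i by simp)] at this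
  simp only [Pi.smul_apply, smul_eq_mul, mul_pow, Finset.prod_mul_distrib,
    Finset.prod_pow_eq_pow_sum, h1]
  ring

/-- The map `[x : y] ↦ [F₀(x, y) : F₁(x, y)]` on points of the projective line. -/
noncomputable def Endo.toFun {F : Type*} [Field F] [IsAlgClosed F] {d : ℕ} (f : Endo F d) : P1 F → P1 F :=
  Projectivization.lift
    (fun v => Projectivization.mk F (fun i => MvPolynomial.eval v.1 (f.form i))
      (f.no_common_zero v.1 v.2))
    (by
      rintro ⟨a, ha⟩ ⟨b, hb⟩ t h
      simp only at h
      subst h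
      refine (Projectivization.mk_eq_mk_iff' F _ _ _ _).mpr ⟨t ^ d, ?_⟩
      funext i
      simp [eval_smul_of_isHomogeneous (f.homogeneous i)])

/-- The Jacobian form `∂F₀/∂x · ∂F₁/∂y - ∂F₀/∂y · ∂F₁/∂x`. -/
noncomputable def Endo.jacobian {F : Type*} [Field F] [IsAlgClosed F] {d : ℕ} (f : Endo F d) :
    MvPolynomial (Fin 2) F :=
  MvPolynomial.pderiv 0 (f.form 0) * MvPolynomial.pderiv 1 (f.form 1)
    - MvPolynomial.pderiv 1 (f.form 0) * MvPolynomial.pderiv 0 (f.form 1)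

/-- Critical points of an endomorphism of the projective line in characteristic zero (possibly
including `∞`): the zeros of the Jacobian form. As that form is homogeneous, the choice of
coordinates of `P` is immaterial. -/
def Endo.IsCritical {F : Type*} [Field F] [IsAlgClosed F] [CharZero F] {d : ℕ} (f : Endo F d)
    (P : P1 F) : Prop :=
  MvPolynomial.eval P.rep f.jacobian = 0

open Classical in
/-- The absolute logarithmic Weil height of a point of the projective line over an algebraic
extension of `ℚ`: the point `[z : 1]` has the absolute logarithmic height of the algebraic number
`z`, and `∞ = [1 : 0]` has height `0`. -/
noncomputable def height {F : Type*} [Field F] [CharZero F] (P : P1 F) : ℝ :=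
  if P.rep 1 = 0 then 0 else NumberField.absLogHeight₁ (P.rep 0 / P.rep 1)

/-- The sequence `h(fⁿ(P)) / dⁿ` whose limit is the canonical height. -/
noncomputable def Endo.heightSeq {F : Type*} [Field F] [IsAlgClosed F] [CharZero F] {d : ℕ}
    (f : Endo F d) (P : P1 F) (n : ℕ) : ℝ :=
  height (f.toFun^[n] P) / (d : ℝ) ^ n

/-- The canonical height `ĥ_f(P) = lim h(fⁿ(P)) / dⁿ`. -/
noncomputable def Endo.canonicalHeight {F : Type*} [Field F] [IsAlgClosed F] [CharZero F] {d : ℕ}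
    (f : Endo F d) (P : P1 F) : ℝ :=
  Filter.limUnder Filter.atTop (f.heightSeq P)

/-- The quadratic morphism `f(z) = (l₀ z + z²) / (l∞ z + 1)`, in homogeneous coordinates
`[x : y] ↦ [l₀ x y + x² : l∞ x y + y²]`. Its numerator and denominator are coprime exactly when
`l₀ l∞ ≠ 1`. -/
noncomputable def quad {F : Type*} [Field F] [IsAlgClosed F] (l₀ linf : F)
    (h : l₀ * linf ≠ 1) : Endo F 2 where
  form := ![MvPolynomial.C l₀ * (MvPolynomial.X 0 * MvPolynomial.X 1) + MvPolynomial.X 0 ^ 2,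
    MvPolynomial.C linf * (MvPolynomial.X 0 * MvPolynomial.X 1) + MvPolynomial.X 1 ^ 2]
  homogeneous := by
    have hXX : (MvPolynomial.X 0 * MvPolynomial.X 1 : MvPolynomial (Fin 2) F).IsHomogeneous 2 :=
      (MvPolynomial.isHomogeneous_X F 0).mul (MvPolynomial.isHomogeneous_X F 1)
    intro i
    fin_cases i
    · exact (hXX.C_mul l₀).add (MvPolynomial.isHomogeneous_X_pow 0 2)
    · exact (hXX.C_mul linf).add (MvPolynomial.isHomogeneous_X_pow 1 2)
  no_common_zero := by
    intro x hx h0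
    have e0 : l₀ * (x 0 * x 1) + x 0 ^ 2 = 0 := by simpa using congrFun h0 0
    have e1 : linf * (x 0 * x 1) + x 1 ^ 2 = 0 := by simpa using congrFun h0 1
    have hne : 1 - l₀ * linf ≠ 0 := fun hh => h (sub_eq_zero.mp hh).symm
    have c0 : x 0 = 0 := by
      have : (1 - l₀ * linf) * x 0 ^ 3 = 0 := by
        linear_combination ((1 - l₀ * linf) * x 0 - l₀ * x 1) * e0 + l₀ ^ 2 * x 0 * e1
      simpa [hne] using this
    have c1 : x 1 = 0 := by simpa [c0] using e1
    exact hx (by funext i; fin_cases i <;> simp [c0, c1])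

end QuadraticMorphism

/-!
If `l∞ = 0`, the right-hand side of the bound is not positive. Otherwise let `l = l₀` and let `s` be
the square root of `1 - l₀ * l∞` such that the critical point is `-l / (1 + s)`. In the coordinate
`w = z / l` the map is `[x : y] ↦ [l x (x + y) : y ((1 - s²) x + y)]` (`step`), and the first
image of the critical point is `w = -l / (1 + s)²`. Over a number field containing these numbers,
the canonical height of this image is, up to the degree, the sum over all places `v` of the
exponential growth rates of `max |l x| |y|` along the lifted orbit (`critOrbit`). A growth rate is
bounded below by means of a gauge: a function `Φ` on pairs with `κ Φ² ≤ Φ ∘ step` satisfies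
`log Φ(stepⁿ p) ≥ 2ⁿ (log Φ(p) + log κ) - log κ` (`log_gauge_iterate`). Two gauges are used.

* The gauge `max |x + y| (D |x|)` measures the distance to `w = -1`, where numerator and
  denominator nearly vanish together for small `s`. Applied to the starting point or to its image,
  it gives at every place the rate `log |s|`, up to terms in `l` and constants
  (`rateAtLeast_general`). This alone is useless, because the sum of all `log |s|` is zero by the
  product formula.
* Where `s` is large, the gauge `max |x| (|y| / |s|)` gives a better rate
  (`rateAtLeast_of_tailGauge`): the second coordinate of the next point of the orbit is
  `(1 + s)³ ((1 + l)(1 + s) - 2 l)`, of size about `|s|⁴ |1 + l|`. A convex combination of the two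
  bounds improves the rate by `1/8 · log⁺ |s| + 1/16 · log |κ|` with `κ = (1 + l)²`. Where
  cancellation spoils the size of this coordinate, `s (1 + l)` is bounded by a multiple of `l`, and
  the first gauge is enough. If `l = -1`, one iterates once more, and `κ = 2`.

As `κ` does not depend on the place, `log |κ|` disappears from the sum over all places, as do
`log |s|` and `log |l|`, and what remains is `h(s) / 8 - 3 / 2 · h(l)` minus the archimedean
constants (`logHeight₁_critOrbit_ge`). This bounds the canonical height of the first image, which is
twice that of the critical point; finally `l∞ = (1 - s²) / l` gives
`h(l∞) ≤ 2 h(s) + h(l) + log 2` (`canonicalHeight_ge`).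

The statement concerns absolute heights, so one also needs that the height relative to a number
field is raised to the power of the degree under extension (`mulHeight₁_algebraMap`). At the
archimedean places this counts extensions of complex embeddings. At the finite places, the local
factors of the height of `a / b` with `a`, `b` integral multiply to the inverse norm of the ideal
`(a, b)`, and the norm of an extended ideal is a power of the norm.
-/

namespace QuadraticMorphism

open NumberField Height

/-! ### Heights under extension of number fields -/

section BaseChange

variable {E K : Type*} [Field E] [NumberField E] [Field K] [NumberField K] [Algebra E K]

/-- A product over infinite places, weighted by multiplicity, is a product over complex
embeddings. -/
theorem prod_infinitePlace_pow_mult (g : InfinitePlace K → ℝ) :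
    ∏ w : InfinitePlace K, g w ^ w.mult = ∏ φ : K →+* ℂ, g (InfinitePlace.mk φ) := by
  classical
  rw [← Finset.prod_fiberwise Finset.univ InfinitePlace.mk]
  refine Finset.prod_congr rfl fun w _ => ?_
  rw [Finset.prod_congr rfl (g := fun _ => g w)
    (fun φ hφ => by rw [(Finset.mem_filter.mp hφ).2]), Finset.prod_const,
    InfinitePlace.card_filter_mk_eq]

/-- Every complex embedding of `E` extends to `[K : E]` complex embeddings of `K`. -/
theorem prod_embeddings_comp_algebraMap (h : (E →+* ℂ) → ℝ) :
    ∏ ψ : K →+* ℂ, h (ψ.comp (algebraMap E K)) =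
      (∏ φ : E →+* ℂ, h φ) ^ Module.finrank E K := by
  classical
  have : FiniteDimensional E K := Module.Finite.of_restrictScalars_finite ℚ E K
  rw [← Finset.prod_fiberwise Finset.univ (fun ψ : K →+* ℂ => ψ.comp (algebraMap E K)),
    ← Finset.prod_pow]
  refine Finset.prod_congr rfl fun φ _ => ?_
  rw [Finset.prod_congr rfl (g := fun _ => h φ)
    (fun ψ hψ => by rw [(Finset.mem_filter.mp hψ).2]), Finset.prod_const]
  congr 1
  let : Algebra E ℂ := φ.toAlgebra
  rw [← AlgHom.card E K ℂ, ← Fintype.card_subtype]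
  refine Fintype.card_congr
    { toFun := fun ψ =>
        { toRingHom := ψ.1
          commutes' := fun r => congrArg (fun f : E →+* ℂ => f r) ψ.2 }
      invFun := fun f => ⟨f.toRingHom, RingHom.ext fun r => f.commutes r⟩
      left_inv := fun ψ => rfl
      right_inv := fun f => rfl }

theorem prod_infinitePlace_algebraMap (x y : E) :
    ∏ w : InfinitePlace K, (⨆ i, w (![algebraMap E K x, algebraMap E K y] i)) ^ w.mult =
      (∏ w : InfinitePlace E, (⨆ i, w (![x, y] i)) ^ w.mult) ^ Module.finrank E K := by
  rw [prod_infinitePlace_pow_mult (fun w => ⨆ i, w (![algebraMap E K x, algebraMap E K y] i)),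
    prod_infinitePlace_pow_mult (fun w => ⨆ i, w (![x, y] i)), ← prod_embeddings_comp_algebraMap]
  refine Finset.prod_congr rfl fun ψ _ => ?_
  congr 1
  funext i
  fin_cases i <;> simp

/-- Both sides are inverse norms of ideals: of the extension to `K` of the ideal `(a, b)`, and of
`(a, b)` itself. -/
theorem prod_finitePlace_algebraMap (a b : 𝓞 E) (hb : b ≠ 0) :
    ∏ᶠ v : FinitePlace K, ⨆ i, v (![algebraMap E K a, algebraMap E K b] i) =
      (∏ᶠ v : FinitePlace E, ⨆ i, v (![(a : E), (b : E)] i)) ^ Module.finrank E K := by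
  set ab : Fin 2 → 𝓞 E := ![a, b] with hab
  set ab' : Fin 2 → 𝓞 K := ![algebraMap (𝓞 E) (𝓞 K) a, algebraMap (𝓞 E) (𝓞 K) b] with hab'
  have inj : Function.Injective (algebraMap (𝓞 E) (𝓞 K)) := FaithfulSMul.algebraMap_injective _ _
  have h1 : ab ≠ 0 := fun h => hb (congrFun h 1)
  have h2 : ab' ≠ 0 := fun h => hb (inj ((congrFun h 1).trans (map_zero _).symm))
  have e1 := absNorm_mul_finprod_finitePlace_eq_one (K := E) h1
  have e2 := absNorm_mul_finprod_finitePlace_eq_one (K := K) h2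
  have hspan : Ideal.span (Set.range ab') =
      (Ideal.span (Set.range ab)).map (algebraMap (𝓞 E) (𝓞 K)) := by
    rw [Ideal.map_span, ← Set.range_comp]
    congr 2
    funext i
    fin_cases i <;> simp [hab, hab']
  rw [hspan, Ideal.absNorm_algebraMap, ← IsFractionRing.finrank_eq (𝓞 E) E (𝓞 K) K] at e2
  have r1 : ∀ v : FinitePlace E, (⨆ i, v (![(a : E), (b : E)] i)) = ⨆ i, v (ab i : E) := by
    intro v; congr 1; funext i; fin_cases i <;> simp [hab]
  have r2 : ∀ v : FinitePlace K, (⨆ i, v (![algebraMap E K a, algebraMap E K b] i)) =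
      ⨆ i, v (ab' i : K) := by
    intro v; congr 1; funext i; fin_cases i <;> rfl
  simp_rw [r1, r2]
  have hN : ((Ideal.span (Set.range ab)).absNorm : ℝ) ≠ 0 := left_ne_zero_of_mul_eq_one e1
  push_cast at e2
  refine mul_left_cancel₀ (pow_ne_zero (Module.finrank E K) hN) ?_
  rw [e2, ← mul_pow, e1, one_pow]

/-- The height relative to a number field is multiplied by the degree under a field extension. -/
theorem mulHeight₁_algebraMap (x : E) :
    mulHeight₁ (algebraMap E K x) = mulHeight₁ x ^ Module.finrank E K := by
  obtain ⟨n, hn, a, ha, -⟩ := exists_nat_ne_zero_exists_integer_mul_eq_and_absNorm_span_eq_pow x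
  have hn' : (n : E) ≠ 0 := by exact_mod_cast hn
  have hx : x = (a : E) / ((n : 𝓞 E) : E) := by
    rw [← ha]; simp [hn']
  have hnE : ((n : 𝓞 E) : E) ≠ 0 := by simpa using hn
  have hnK : algebraMap E K ((n : 𝓞 E) : E) ≠ 0 := by simpa using hn
  rw [hx, map_div₀, mulHeight₁_div_eq_mulHeight, mulHeight₁_div_eq_mulHeight,
    NumberField.mulHeight_eq (x := ![(a : E), ((n : 𝓞 E) : E)]) (fun h => hnE (congrFun h 1)),
    NumberField.mulHeight_eq (x := ![algebraMap E K a, algebraMap E K ((n : 𝓞 E) : E)])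
      (fun h => hnK (congrFun h 1)),
    prod_infinitePlace_algebraMap, prod_finitePlace_algebraMap a n (by exact_mod_cast hn), mul_pow]

end BaseChange

/-- The absolute height may be computed in any number field containing the given number. -/
theorem absLogHeight₁_algebraMap {K F : Type*} [Field K] [NumberField K] [Field F] [CharZero F]
    [Algebra K F] (x : K) :
    absLogHeight₁ (algebraMap K F x) = logHeight₁ x / Module.finrank ℚ K := by
  have hint : IsIntegral ℚ x := Algebra.IsIntegral.isIntegral x
  have hx : IsIntegral ℚ (algebraMap K F x) := hint.map (algebraMap K F).toRatAlgHom
  set y := algebraMap K F x with hy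
  have : FiniteDimensional ℚ (IntermediateField.adjoin ℚ {y}) :=
    IntermediateField.adjoin.finiteDimensional hx
  have : NumberField (IntermediateField.adjoin ℚ {y}) := {}
  -- the field `ℚ(y)` embeds into `K`, because `y` lies in the image of `K`
  let j : K →ₐ[ℚ] F := (algebraMap K F).toRatAlgHom
  have hle : IntermediateField.adjoin ℚ {y} ≤ j.fieldRange := by
    rw [IntermediateField.adjoin_simple_le_iff]
    exact ⟨x, rfl⟩
  let e : K ≃ₐ[ℚ] j.fieldRange := AlgEquiv.ofInjectiveField j
  let i : IntermediateField.adjoin ℚ {y} →ₐ[ℚ] K :=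
    e.symm.toAlgHom.comp (IntermediateField.inclusion hle)
  let : Algebra (IntermediateField.adjoin ℚ {y}) K := i.toRingHom.toAlgebra
  have hgen : algebraMap (IntermediateField.adjoin ℚ {y}) K
      (IntermediateField.AdjoinSimple.gen ℚ y) = x := by
    apply e.injective
    change e (e.symm _) = _
    rw [AlgEquiv.apply_symm_apply]
    exact Subtype.ext rfl
  have : IsScalarTower ℚ (IntermediateField.adjoin ℚ {y}) K :=
    IsScalarTower.of_algebraMap_eq fun r => (i.commutes r).symm
  have hpow := mulHeight₁_algebraMap (K := K) (IntermediateField.AdjoinSimple.gen ℚ y)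
  rw [hgen] at hpow
  have hfin : Module.finrank ℚ (IntermediateField.adjoin ℚ {y}) *
      Module.finrank (IntermediateField.adjoin ℚ {y}) K = Module.finrank ℚ K :=
    Module.finrank_mul_finrank _ _ _
  have hpos : 0 < Module.finrank ℚ K := Module.finrank_pos
  have hne := hfin ▸ hpos.ne'
  obtain ⟨h1, h2⟩ := mul_ne_zero_iff.mp hne
  rw [absLogHeight₁, absMulHeight₁, dif_pos hx, Real.log_rpow (mulHeight₁_pos _),
    logHeight₁, hpow, Real.log_pow, ← hfin]
  push_cast
  field_simp

/-! ### Sums over places and the product formula -/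

theorem log_max_eq_posLog_div_add {K : Type*} [Field K] {v : AbsoluteValue K ℝ} (x : K) {y : K}
    (hy : y ≠ 0) :
    Real.log (max (v x) (v y)) = Real.posLog (v (x / y)) + Real.log (v y) := by
  have h : 0 < v y := v.pos hy
  rw [Real.posLog_eq_log_max_one (v.nonneg _), ← Real.log_mul (by positivity) h.ne', map_div₀,
    max_mul_of_nonneg _ _ h.le, one_mul, div_mul_cancel₀ _ h.ne', max_comm]

section PlaceSum

open Height.AdmissibleAbsValues Function

variable {K : Type*} [Field K] [AdmissibleAbsValues K]

/-- The sum of a function over all places of `K`, the archimedean ones counted with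
multiplicity. -/
noncomputable def placeSum (φ : AbsoluteValue K ℝ → ℝ) : ℝ :=
  (archAbsVal.map φ).sum + ∑ᶠ v : nonarchAbsVal (K := K), φ v.1

/-- The function vanishes at all but finitely many nonarchimedean places. -/
def FinitelySupported (φ : AbsoluteValue K ℝ → ℝ) : Prop :=
  (fun v : nonarchAbsVal (K := K) => φ v.1).HasFiniteSupport

theorem FinitelySupported.add {φ ψ : AbsoluteValue K ℝ → ℝ} (hφ : FinitelySupported φ)
    (hψ : FinitelySupported ψ) : FinitelySupported fun v => φ v + ψ v :=
  HasFiniteSupport.add hφ hψ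

theorem FinitelySupported.const_mul {φ : AbsoluteValue K ℝ → ℝ} (hφ : FinitelySupported φ)
    (c : ℝ) : FinitelySupported fun v => c * φ v :=
  Set.Finite.subset hφ fun v hv h => hv (by simp only [h, mul_zero])

theorem placeSum_add {φ ψ : AbsoluteValue K ℝ → ℝ} (hφ : FinitelySupported φ)
    (hψ : FinitelySupported ψ) :
    placeSum (fun v => φ v + ψ v) = placeSum φ + placeSum ψ := by
  rw [placeSum, placeSum, placeSum, Multiset.sum_map_add, finsum_add_distrib hφ hψ]
  ring

theorem placeSum_const_mul (φ : AbsoluteValue K ℝ → ℝ) (c : ℝ) :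
    placeSum (fun v => c * φ v) = c * placeSum φ := by
  rw [placeSum, placeSum, Multiset.sum_map_mul_left, mul_add, mul_finsum]

theorem placeSum_le {φ ψ : AbsoluteValue K ℝ → ℝ} (hφ : FinitelySupported φ)
    (hψ : FinitelySupported ψ) (C : ℝ) (harch : ∀ v ∈ archAbsVal (K := K), φ v ≤ ψ v + C)
    (hnon : ∀ v ∈ nonarchAbsVal (K := K), φ v ≤ ψ v) :
    placeSum φ ≤ placeSum ψ + totalWeight K * C := by
  have h1 : (archAbsVal.map φ).sum ≤ (archAbsVal.map fun v => ψ v + C).sum :=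
    Multiset.sum_map_le_sum_map _ _ harch
  have h2 : ∑ᶠ v : nonarchAbsVal (K := K), φ v.1 ≤ ∑ᶠ v : nonarchAbsVal (K := K), ψ v.1 := by
    rw [← sub_nonneg, ← finsum_sub_distrib hψ hφ]
    exact finsum_nonneg fun v => sub_nonneg.mpr (hnon v.1 v.2)
  rw [Multiset.sum_map_add, Multiset.map_const', Multiset.sum_replicate, nsmul_eq_mul] at h1
  simp only [placeSum, totalWeight]
  linarith

theorem finitelySupported_log {a : K} (ha : a ≠ 0) :
    FinitelySupported fun v => Real.log (v a) :=
  Set.Finite.subset (AdmissibleAbsValues.hasFiniteMulSupport ha) fun v hv h => hv (by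
    simp only at h
    simp [h])

/-- The product formula. -/
theorem placeSum_log {a : K} (ha : a ≠ 0) : placeSum (fun v => Real.log (v a)) = 0 := by
  have h := congrArg Real.log (product_formula ha)
  have hpos : ∀ v : AbsoluteValue K ℝ, v a ≠ 0 := fun v => v.ne_zero ha
  have hne := (AdmissibleAbsValues.product_formula ha).symm ▸ one_ne_zero (α := ℝ)
  rw [Real.log_mul (left_ne_zero_of_mul hne) (right_ne_zero_of_mul hne),
    Real.log_multiset_prod, Multiset.map_map, Real.log_finprod, Real.log_one] at h
  · exact h
  · exact fun v => v.1.pos ha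
  · intro x hx
    obtain ⟨v, -, rfl⟩ := Multiset.mem_map.mp hx
    exact hpos v

theorem finitelySupported_posLog (a : K) : FinitelySupported fun v => Real.posLog (v a) := by
  rcases eq_or_ne a 0 with rfl | ha
  · exact Set.Finite.subset Set.finite_empty fun v hv => hv (by simp [Real.posLog])
  · exact Set.Finite.subset (finitelySupported_log ha) fun v hv h => hv (by
      simp only at h
      simp [Real.posLog, h])

theorem placeSum_posLog (a : K) : placeSum (fun v => Real.posLog (v a)) = logHeight₁ a :=
  (logHeight₁_eq a).symm

theorem finitelySupported_log_max {x y : K} (h : x ≠ 0 ∨ y ≠ 0) :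
    FinitelySupported fun v => Real.log (max (v x) (v y)) := by
  by_cases hy : y = 0
  · subst hy
    simpa using finitelySupported_log (h.resolve_right (by simp))
  · simp_rw [log_max_eq_posLog_div_add x hy]
    exact (finitelySupported_posLog _).add (finitelySupported_log hy)

theorem placeSum_log_max {x y : K} (h : x ≠ 0 ∨ y ≠ 0) :
    placeSum (fun v => Real.log (max (v x) (v y))) = logHeight₁ (x / y) := by
  by_cases hy : y = 0
  · subst hy
    simpa using placeSum_log (h.resolve_right (by simp))
  · simp_rw [log_max_eq_posLog_div_add x hy]
    rw [placeSum_add (finitelySupported_posLog _) (finitelySupported_log hy), placeSum_posLog,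
      placeSum_log hy, add_zero]

end PlaceSum

/-! ### Gauges and growth rates of the critical orbit -/

section LocalGrowth

variable {K : Type*} [Field K]

/-- The quadratic map in the coordinate `w = z / l₀`, lifted to pairs of homogeneous
coordinates and written in terms of `l = l₀` and `s`, where `s ^ 2 = 1 - l₀ * l∞`. -/
def step (l s : K) (p : K × K) : K × K :=
  (l * p.1 * (p.1 + p.2), p.2 * ((1 - s ^ 2) * p.1 + p.2))

/-- The lifted orbit of the first image `w = -l / (1 + s) ^ 2` of a critical point. -/
def critOrbit (l s : K) (n : ℕ) : K × K :=
  (step l s)^[n] (-l, (1 + s) ^ 2)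

theorem critOrbit_succ (l s : K) (n : ℕ) :
    critOrbit l s (n + 1) = step l s (critOrbit l s n) :=
  Function.iterate_succ_apply' _ _ _

theorem step_ne_zero {l s : K} (hl : l ≠ 0) (hs : s ≠ 0) {p : K × K} (hp : p ≠ 0) :
    step l s p ≠ 0 := by
  obtain ⟨x, y⟩ := p
  intro h
  have h1 : l * x * (x + y) = 0 := congrArg Prod.fst h
  have h2 : y * ((1 - s ^ 2) * x + y) = 0 := congrArg Prod.snd h
  apply hp
  rcases mul_eq_zero.mp h1 with h1 | h1
  · have hx : x = 0 := (mul_eq_zero.mp h1).resolve_left hl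
    have hy : y = 0 := by simpa [hx] using h2
    rw [hx, hy]; rfl
  · have hy : y = -x := by linear_combination h1
    have hx : x = 0 := by
      have : s ^ 2 * x ^ 2 = 0 := by rw [hy] at h2; linear_combination h2
      simpa [hs] using this
    rw [hy, hx, neg_zero]; rfl

theorem critOrbit_ne_zero {l s : K} (hl : l ≠ 0) (hs : s ≠ 0) (n : ℕ) :
    critOrbit l s n ≠ 0 := by
  induction n with
  | zero => exact fun h => hl (neg_eq_zero.mp (congrArg Prod.fst h))
  | succ n ih => rw [critOrbit_succ]; exact step_ne_zero hl hs ih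

/-- A gauge `Φ` with `κ * Φ ^ 2 ≤ Φ ∘ f` grows doubly exponentially along orbits. -/
theorem log_gauge_iterate {α : Type*} {f : α → α} {Φ : α → ℝ} {κ : ℝ} (hκ : 0 < κ)
    (h : ∀ p, κ * Φ p ^ 2 ≤ Φ (f p)) {p : α} (hp : 0 < Φ p) (n : ℕ) :
    0 < Φ (f^[n] p) ∧
      2 ^ n * (Real.log (Φ p) + Real.log κ) - Real.log κ ≤ Real.log (Φ (f^[n] p)) := by
  induction n with
  | zero => simpa using hp
  | succ n ih =>
    obtain ⟨ih1, ih2⟩ := ih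
    rw [Function.iterate_succ_apply']
    have hlow : 0 < κ * Φ (f^[n] p) ^ 2 := by positivity
    refine ⟨hlow.trans_le (h _), ?_⟩
    have := Real.log_le_log hlow (h (f^[n] p))
    rw [Real.log_mul hκ.ne' (by positivity), Real.log_pow] at this
    push_cast at this
    rw [pow_succ]
    linarith

/-- `RateAtLeast v l s E g` says that `g` bounds from below the exponential growth rate at `v`
of the critical orbit, in the coordinates `[l * x : y]` of the original variable, up to the error
`E` in the logarithm. -/
def RateAtLeast (v : AbsoluteValue K ℝ) (l s : K) (E g : ℝ) : Prop :=
  ∀ n ≥ 2, 2 ^ n * g - E ≤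
    Real.log (max (v (l * (critOrbit l s n).1)) (v (critOrbit l s n).2))

theorem RateAtLeast.mono {v : AbsoluteValue K ℝ} {l s : K} {E g g' : ℝ}
    (h : RateAtLeast v l s E g) (hg : g' ≤ g) : RateAtLeast v l s E g' := fun n hn =>
  (sub_le_sub_right (mul_le_mul_of_nonneg_left hg (by positivity)) E).trans (h n hn)

/-- Growth rates may be interpolated. -/
theorem RateAtLeast.convex {v : AbsoluteValue K ℝ} {l s : K} {E g g' : ℝ}
    (h : RateAtLeast v l s E g) (h' : RateAtLeast v l s E g') :
    RateAtLeast v l s E (3 / 4 * g + 1 / 4 * g') := fun n hn => by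
  have h1 := h n hn
  have h2 := h' n hn
  linarith

/-- A gauge that is bounded by the coordinates gives a lower bound for the growth rate, in terms of
its value at the `m`-th point of the orbit. -/
theorem rateAtLeast_of_gauge {v : AbsoluteValue K ℝ} {l s : K} {Φ : K × K → ℝ} {κ C E : ℝ}
    (hκ : 0 < κ) (hC : 0 < C) (h : ∀ p, κ * Φ p ^ 2 ≤ Φ (step l s p))
    (hcomp : ∀ p, Φ p ≤ C * max (v (l * p.1)) (v p.2)) (hE : Real.log κ + Real.log C ≤ E)
    {m : ℕ} (hm : m ≤ 2) (hpos : 0 < Φ (critOrbit l s m)) :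
    RateAtLeast v l s E ((Real.log (Φ (critOrbit l s m)) + Real.log κ) / 2 ^ m) := fun n hn => by
  obtain ⟨k, rfl⟩ := Nat.exists_eq_add_of_le (hm.trans hn)
  have hit : critOrbit l s (m + k) = (step l s)^[k] (critOrbit l s m) := by
    rw [add_comm, critOrbit, Function.iterate_add_apply]; rfl
  obtain ⟨h1, h2⟩ := log_gauge_iterate hκ h hpos k
  rw [hit]
  set q := (step l s)^[k] (critOrbit l s m)
  have h3 := hcomp q
  have h4 : 0 < max (v (l * q.1)) (v q.2) := pos_of_mul_pos_right (h1.trans_le h3) hC.le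
  have h5 := Real.log_le_log h1 h3
  rw [Real.log_mul hC.ne' h4.ne'] at h5
  have h6 : (2 : ℝ) ^ (m + k) * ((Real.log (Φ (critOrbit l s m)) + Real.log κ) / 2 ^ m) =
      2 ^ k * (Real.log (Φ (critOrbit l s m)) + Real.log κ) := by
    rw [pow_add]; field_simp
  rw [h6]
  linarith

/-- The scale `D` of the gauge that measures the distance to the point `w = -1`, where numerator
and denominator of the map come close to a common zero as `s` tends to `0`. -/
noncomputable def holeScale (v : AbsoluteValue K ℝ) (l s : K) : ℝ :=
  max (v s) (v (1 - l + s ^ 2))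

/-- The gauge `max |x + y| (D |x|)`. -/
noncomputable def holeGauge (v : AbsoluteValue K ℝ) (l s : K) (p : K × K) : ℝ :=
  max (v (p.1 + p.2)) (holeScale v l s * v p.1)

theorem step_sum (l s : K) (p : K × K) :
    (step l s p).1 + (step l s p).2 =
      (p.1 + p.2) ^ 2 - (1 - l + s ^ 2) * (p.1 + p.2) * p.1 + s ^ 2 * p.1 ^ 2 := by
  simp only [step]; ring

theorem holeScale_pos (v : AbsoluteValue K ℝ) (l : K) {s : K} (hs : s ≠ 0) :
    0 < holeScale v l s :=
  lt_max_of_lt_left (v.pos hs)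

/-- The estimate behind `holeGauge_step`, with `e = |x + y|`, `X = |x|` and `e'` the absolute value
of the sum of the coordinates of the image. -/
theorem hole_estimate {S D L μ X e e' : ℝ} (hS : 0 < S) (hSD : S ≤ D) (hμ : 0 < μ) (hμ1 : μ ≤ 1)
    (hμL : μ ≤ L) (hX : 0 ≤ X) (he : 0 ≤ e) (h1 : S ^ 2 * X ^ 2 ≤ e' + D * e * X + e ^ 2)
    (h2 : e ^ 2 ≤ e' + D * e * X + S ^ 2 * X ^ 2) :
    μ * S ^ 2 * max e (D * X) ^ 2 ≤ 5 / 2 * D ^ 2 * max e' (D * (L * X * e)) := by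
  have hD : 0 < D := hS.trans_le hSD
  have hSD2 : S ^ 2 ≤ D ^ 2 := pow_le_pow_left₀ hS.le hSD 2
  have hXe : 0 ≤ D * (X * e) := by positivity
  have hmid : μ * (D * (X * e)) ≤ max e' (D * (L * X * e)) :=
    (mul_le_mul_of_nonneg_right hμL hXe).trans (le_max_of_le_right (by linarith))
  rcases le_total e (D * X) with hc | hc
  · rw [max_eq_right hc]
    suffices h : μ * (S ^ 2 * X ^ 2) ≤ 5 / 2 * max e' (D * (L * X * e)) by
      have := mul_le_mul_of_nonneg_left h (sq_nonneg D)
      linarith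
    have hSX : 0 ≤ S ^ 2 * X ^ 2 := by positivity
    rcases le_total (2 / 5 * (S ^ 2 * X)) (D * e) with hd | hd
    · have h3 : 2 / 5 * (S ^ 2 * X ^ 2) ≤ D * (X * e) := by
        nlinarith [mul_le_mul_of_nonneg_right hd hX]
      have := mul_le_mul_of_nonneg_left h3 hμ.le
      linarith
    · have h3 : D * e * X ≤ 2 / 5 * (S ^ 2 * X ^ 2) := by
        nlinarith [mul_le_mul_of_nonneg_right hd hX]
      have h4 : e ≤ 2 / 5 * (S * X) := by
        have : S * e ≤ S * (2 / 5 * (S * X)) := by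
          nlinarith [mul_le_mul_of_nonneg_right hSD he]
        exact le_of_mul_le_mul_left this hS
      have h5 : e ^ 2 ≤ 4 / 25 * (S ^ 2 * X ^ 2) := by
        have := pow_le_pow_left₀ he h4 2
        linarith
      have h6 : 2 / 5 * (S ^ 2 * X ^ 2) ≤ e' := by linarith
      have h7 : μ * (S ^ 2 * X ^ 2) ≤ S ^ 2 * X ^ 2 := mul_le_of_le_one_left hSX hμ1
      have := le_max_left e' (D * (L * X * e))
      linarith
  · rw [max_eq_left hc]
    suffices h : μ * e ^ 2 ≤ 5 / 2 * max e' (D * (L * X * e)) by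
      have h3 := mul_le_mul_of_nonneg_left h (sq_nonneg D)
      have h4 : S ^ 2 * (μ * e ^ 2) ≤ D ^ 2 * (μ * e ^ 2) :=
        mul_le_mul_of_nonneg_right hSD2 (by positivity)
      linarith
    rcases le_total e (5 / 2 * (D * X)) with hd | hd
    · have h3 : e ^ 2 ≤ 5 / 2 * (D * (X * e)) := by nlinarith
      have := mul_le_mul_of_nonneg_left h3 hμ.le
      linarith
    · have h3 : D * e * X ≤ 2 / 5 * e ^ 2 := by nlinarith
      have h4 : S * X ≤ 2 / 5 * e := by
        have := mul_le_mul_of_nonneg_right hSD hX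
        linarith
      have h5 : S ^ 2 * X ^ 2 ≤ 4 / 25 * e ^ 2 := by
        have := pow_le_pow_left₀ (by positivity) h4 2
        linarith
      have h7 : μ * e ^ 2 ≤ e ^ 2 := mul_le_of_le_one_left (by positivity) hμ1
      have := le_max_left e' (D * (L * X * e))
      linarith

/-- The sharper ultrametric form of `hole_estimate`. -/
theorem hole_estimate_nonarch {S D L μ X e e' : ℝ} (hS : 0 < S) (hSD : S ≤ D) (hμ : 0 < μ)
    (hμ1 : μ ≤ 1) (hμL : μ ≤ L) (hX : 0 ≤ X) (he : 0 ≤ e)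
    (h1 : S ^ 2 * X ^ 2 ≤ max e' (max (D * e * X) (e ^ 2)))
    (h2 : e ^ 2 ≤ max e' (max (D * e * X) (S ^ 2 * X ^ 2))) :
    μ * S ^ 2 * max e (D * X) ^ 2 ≤ D ^ 2 * max e' (D * (L * X * e)) := by
  have hD : 0 < D := hS.trans_le hSD
  have hSD2 : S ^ 2 ≤ D ^ 2 := pow_le_pow_left₀ hS.le hSD 2
  have hXe : 0 ≤ D * (X * e) := by positivity
  have hmid : μ * (D * (X * e)) ≤ max e' (D * (L * X * e)) :=
    (mul_le_mul_of_nonneg_right hμL hXe).trans (le_max_of_le_right (by linarith))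
  have hleft := le_max_left e' (D * (L * X * e))
  rcases le_total e (D * X) with hc | hc
  · rw [max_eq_right hc]
    suffices h : μ * (S ^ 2 * X ^ 2) ≤ max e' (D * (L * X * e)) by
      have := mul_le_mul_of_nonneg_left h (sq_nonneg D)
      linarith
    have h7 : μ * (S ^ 2 * X ^ 2) ≤ S ^ 2 * X ^ 2 := mul_le_of_le_one_left (by positivity) hμ1
    rcases le_or_gt (S ^ 2 * X) (D * e) with hd | hd
    · have h3 : S ^ 2 * X ^ 2 ≤ D * (X * e) := by
        nlinarith [mul_le_mul_of_nonneg_right hd hX]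
      exact (mul_le_mul_of_nonneg_left h3 hμ.le).trans hmid
    · have hX0 : 0 < X := by
        rcases hX.eq_or_lt with h | h
        · rw [← h, mul_zero] at hd
          exact absurd hd (not_lt.mpr (by positivity))
        · exact h
      have h3 : D * e * X < S ^ 2 * X ^ 2 := by
        nlinarith [mul_lt_mul_of_pos_right hd hX0]
      have h4 : e < S * X := by
        have : S * e < S * (S * X) := by
          nlinarith [mul_le_mul_of_nonneg_right hSD he]
        exact lt_of_mul_lt_mul_left this hS.le
      have h5 : e ^ 2 < S ^ 2 * X ^ 2 := by
        have := pow_lt_pow_left₀ h4 he two_ne_zero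
        linarith
      rcases le_max_iff.mp h1 with h6 | h6
      · linarith
      · exact absurd (max_lt h3 h5) (not_lt.mpr h6)
  · rw [max_eq_left hc]
    suffices h : μ * e ^ 2 ≤ max e' (D * (L * X * e)) by
      have h3 := mul_le_mul_of_nonneg_left h (sq_nonneg D)
      have h4 : S ^ 2 * (μ * e ^ 2) ≤ D ^ 2 * (μ * e ^ 2) :=
        mul_le_mul_of_nonneg_right hSD2 (by positivity)
      linarith
    have h7 : μ * e ^ 2 ≤ e ^ 2 := mul_le_of_le_one_left (by positivity) hμ1
    rcases hc.eq_or_lt with hd | hd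
    · have h3 : e ^ 2 ≤ D * (X * e) := by nlinarith
      exact (mul_le_mul_of_nonneg_left h3 hμ.le).trans hmid
    · have he0 : 0 < e := lt_of_le_of_lt (by positivity) hd
      have h3 : D * e * X < e ^ 2 := by nlinarith
      have h4 : S * X < e := (mul_le_mul_of_nonneg_right hSD hX).trans_lt hd
      have h5 : S ^ 2 * X ^ 2 < e ^ 2 := by
        have := pow_lt_pow_left₀ h4 (by positivity) two_ne_zero
        linarith
      rcases le_max_iff.mp h2 with h6 | h6
      · linarith
      · exact absurd (max_lt h3 h5) (not_lt.mpr h6)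

end LocalGrowth

/-! ### Growth rates from the gauge at `w = -1` -/

section HoleGauge

variable {K : Type*} [Field K] {v : AbsoluteValue K ℝ} {l s : K}

theorem map_step_fst (p : K × K) : v (step l s p).1 = v l * v p.1 * v (p.1 + p.2) := by
  simp only [step, map_mul]

theorem holeGauge_step (hl : l ≠ 0) (hs : s ≠ 0) (p : K × K) :
    min 1 (v l) * (v s / holeScale v l s) ^ 2 / (5 / 2) * holeGauge v l s p ^ 2 ≤
      holeGauge v l s (step l s p) := by
  have hS := v.pos hs
  have hD := holeScale_pos v l hs
  have hδ : v ((1 - l + s ^ 2) * (p.1 + p.2) * p.1) ≤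
      holeScale v l s * v (p.1 + p.2) * v p.1 := by
    rw [map_mul, map_mul]
    gcongr
    exact le_max_right _ _
  have h1 : v s ^ 2 * v p.1 ^ 2 ≤ v ((step l s p).1 + (step l s p).2) +
      holeScale v l s * v (p.1 + p.2) * v p.1 + v (p.1 + p.2) ^ 2 := by
    have e : s ^ 2 * p.1 ^ 2 = ((step l s p).1 + (step l s p).2) +
        (1 - l + s ^ 2) * (p.1 + p.2) * p.1 - (p.1 + p.2) ^ 2 := by rw [step_sum]; ring
    rw [← map_pow, ← map_pow, ← map_pow, ← map_mul, e]
    refine (v.sub_le_add _ _).trans ?_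
    have := v.add_le ((step l s p).1 + (step l s p).2) ((1 - l + s ^ 2) * (p.1 + p.2) * p.1)
    linarith
  have h2 : v (p.1 + p.2) ^ 2 ≤ v ((step l s p).1 + (step l s p).2) +
      holeScale v l s * v (p.1 + p.2) * v p.1 + v s ^ 2 * v p.1 ^ 2 := by
    have e : (p.1 + p.2) ^ 2 = ((step l s p).1 + (step l s p).2) +
        (1 - l + s ^ 2) * (p.1 + p.2) * p.1 - s ^ 2 * p.1 ^ 2 := by rw [step_sum]; ring
    rw [← map_pow v (p.1 + p.2), e]
    refine (v.sub_le_add _ _).trans ?_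
    have := v.add_le ((step l s p).1 + (step l s p).2) ((1 - l + s ^ 2) * (p.1 + p.2) * p.1)
    rw [map_mul v (s ^ 2), map_pow, map_pow]
    linarith
  have key := hole_estimate (D := holeScale v l s) hS (le_max_left _ _)
    (lt_min one_pos (v.pos hl)) (min_le_left _ _) (min_le_right _ _) (v.nonneg _) (v.nonneg _) h1 h2
  rw [holeGauge, holeGauge, map_step_fst, div_pow, div_eq_mul_inv, mul_assoc]
  rw [mul_div_assoc', div_mul_eq_mul_div, div_le_iff₀ (by positivity)]
  linarith

theorem holeGauge_step_nonarch (hv : IsNonarchimedean v) (hl : l ≠ 0) (hs : s ≠ 0) (p : K × K) :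
    min 1 (v l) * (v s / holeScale v l s) ^ 2 / 1 * holeGauge v l s p ^ 2 ≤
      holeGauge v l s (step l s p) := by
  have hS := v.pos hs
  have hD := holeScale_pos v l hs
  have hδ : v ((1 - l + s ^ 2) * (p.1 + p.2) * p.1) ≤
      holeScale v l s * v (p.1 + p.2) * v p.1 := by
    rw [map_mul, map_mul]
    gcongr
    exact le_max_right _ _
  have h1 : v s ^ 2 * v p.1 ^ 2 ≤ max (v ((step l s p).1 + (step l s p).2))
      (max (holeScale v l s * v (p.1 + p.2) * v p.1) (v (p.1 + p.2) ^ 2)) := by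
    have e : s ^ 2 * p.1 ^ 2 = ((step l s p).1 + (step l s p).2) +
        ((1 - l + s ^ 2) * (p.1 + p.2) * p.1 + -(p.1 + p.2) ^ 2) := by rw [step_sum]; ring
    rw [← map_pow, ← map_pow, ← map_pow, ← map_mul, e]
    refine (hv _ _).trans (max_le_max_left _ ((hv _ _).trans (max_le_max hδ ?_)))
    rw [v.map_neg]
  have h2 : v (p.1 + p.2) ^ 2 ≤ max (v ((step l s p).1 + (step l s p).2))
      (max (holeScale v l s * v (p.1 + p.2) * v p.1) (v s ^ 2 * v p.1 ^ 2)) := by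
    have e : (p.1 + p.2) ^ 2 = ((step l s p).1 + (step l s p).2) +
        ((1 - l + s ^ 2) * (p.1 + p.2) * p.1 + -(s ^ 2 * p.1 ^ 2)) := by rw [step_sum]; ring
    rw [← map_pow v (p.1 + p.2), e]
    refine (hv _ _).trans (max_le_max_left _ ((hv _ _).trans (max_le_max hδ ?_)))
    rw [v.map_neg, map_mul, map_pow, map_pow]
  have key := hole_estimate_nonarch (D := holeScale v l s) hS (le_max_left _ _)
    (lt_min one_pos (v.pos hl)) (min_le_left _ _) (min_le_right _ _) (v.nonneg _) (v.nonneg _) h1 h2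
  rw [holeGauge, holeGauge, map_step_fst, div_pow, div_one]
  rw [mul_div_assoc', div_mul_eq_mul_div, div_le_iff₀ (by positivity)]
  linarith

/-- The error term of the growth estimates; it is finitely supported as a function of `v`. -/
noncomputable def baseError (v : AbsoluteValue K ℝ) (l s : K) : ℝ :=
  Real.posLog (v s) + Real.posLog (v (1 - l + s ^ 2)) + Real.posLog (v l) + Real.posLog (v l⁻¹)

theorem map_le_max_inv_mul (hl : l ≠ 0) (x : K) : v x ≤ max 1 (v l⁻¹) * v (l * x) := by
  have : v x = v l⁻¹ * v (l * x) := by rw [← map_mul, inv_mul_cancel_left₀ hl]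
  rw [this]
  exact mul_le_mul_of_nonneg_right (le_max_right _ _) (v.nonneg _)

theorem fst_le (hl : l ≠ 0) (p : K × K) :
    v p.1 ≤ max 1 (v l⁻¹) * max (v (l * p.1)) (v p.2) :=
  (map_le_max_inv_mul hl _).trans (by gcongr; exact le_max_left _ _)

theorem snd_le (p : K × K) :
    v p.2 ≤ max 1 (v l⁻¹) * max (v (l * p.1)) (v p.2) :=
  (le_max_right _ _).trans
    (le_mul_of_one_le_left ((v.nonneg _).trans (le_max_right _ _)) (le_max_left _ _))

theorem holeGauge_le_of_sum_le {b : ℝ} (hb : 1 ≤ b) (hl : l ≠ 0) {p : K × K}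
    (h : v (p.1 + p.2) ≤ b * max (v p.1) (v p.2)) :
    holeGauge v l s p ≤
      b * max 1 (holeScale v l s) * max 1 (v l⁻¹) * max (v (l * p.1)) (v p.2) := by
  have hm : 0 ≤ max 1 (v l⁻¹) * max (v (l * p.1)) (v p.2) := (v.nonneg _).trans (snd_le p)
  have h1 : max (v p.1) (v p.2) ≤ max 1 (v l⁻¹) * max (v (l * p.1)) (v p.2) :=
    max_le (fst_le hl p) (snd_le p)
  have hb0 : 0 ≤ b := zero_le_one.trans hb
  rw [mul_assoc]
  refine max_le (h.trans ?_) ?_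
  · have : b ≤ b * max 1 (holeScale v l s) := le_mul_of_one_le_right hb0 (le_max_left _ _)
    exact mul_le_mul this h1 ((v.nonneg _).trans (le_max_left _ _)) (hb0.trans this)
  · have h2 : holeScale v l s ≤ b * max 1 (holeScale v l s) :=
      (le_max_right _ _).trans
        (le_mul_of_one_le_left (zero_le_one.trans (le_max_left _ _)) hb)
    have h3 : 0 ≤ b * max 1 (holeScale v l s) :=
      mul_nonneg hb0 (zero_le_one.trans (le_max_left _ _))
    exact mul_le_mul h2 (fst_le hl p) (v.nonneg _) h3

theorem log_max_one_holeScale_le :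
    Real.log (max 1 (holeScale v l s)) ≤
      Real.posLog (v s) + Real.posLog (v (1 - l + s ^ 2)) := by
  rw [Real.posLog_eq_log_max_one (v.nonneg _), Real.posLog_eq_log_max_one (v.nonneg _),
    ← Real.log_mul (by positivity) (by positivity)]
  have h1 : 1 ≤ max 1 (v s) := le_max_left _ _
  have h2 : 1 ≤ max 1 (v (1 - l + s ^ 2)) := le_max_left _ _
  refine Real.log_le_log (by positivity) (max_le (one_le_mul_of_one_le_of_one_le h1 h2)
    (max_le ?_ ?_))
  · exact (le_max_right _ _).trans (le_mul_of_one_le_right (by positivity) h2)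
  · exact (le_max_right _ _).trans (le_mul_of_one_le_left (by positivity) h1)

theorem rateAtLeast_of_holeGauge {b c A : ℝ} (hb : 1 ≤ b) (hc : 1 ≤ c) (hl : l ≠ 0) (hs : s ≠ 0)
    (hstep : ∀ p : K × K, min 1 (v l) * (v s / holeScale v l s) ^ 2 / c *
      holeGauge v l s p ^ 2 ≤ holeGauge v l s (step l s p))
    (hsum : ∀ p : K × K, v (p.1 + p.2) ≤ b * max (v p.1) (v p.2)) {m : ℕ} (hm : m ≤ 2)
    (hA : 0 < A) (h : A ≤ holeGauge v l s (critOrbit l s m)) :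
    RateAtLeast v l s (Real.log b + baseError v l s)
      ((Real.log A + (Real.log (min 1 (v l)) + 2 * Real.log (v s) -
        2 * Real.log (holeScale v l s) - Real.log c)) / 2 ^ m) := by
  have hS := v.pos hs
  have hL := v.pos hl
  have hD := holeScale_pos v l hs
  have hμ : 0 < min 1 (v l) := lt_min one_pos hL
  have hc0 : 0 < c := one_pos.trans_le hc
  have hb0 : 0 < b := one_pos.trans_le hb
  have hκ : 0 < min 1 (v l) * (v s / holeScale v l s) ^ 2 / c := by positivity
  have hκ1 : min 1 (v l) * (v s / holeScale v l s) ^ 2 / c ≤ 1 := by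
    have h1 : v s / holeScale v l s ≤ 1 := (div_le_one hD).mpr (le_max_left _ _)
    refine div_le_one_of_le₀ ((mul_le_one₀ (min_le_left _ _) (by positivity)
      (pow_le_one₀ (by positivity) h1)).trans hc) hc0.le
  have hlogκ : Real.log (min 1 (v l) * (v s / holeScale v l s) ^ 2 / c) =
      Real.log (min 1 (v l)) + 2 * Real.log (v s) - 2 * Real.log (holeScale v l s) -
        Real.log c := by
    rw [Real.log_div (by positivity) hc0.ne', Real.log_mul hμ.ne' (by positivity), Real.log_pow,
      Real.log_div hS.ne' hD.ne']
    push_cast; ring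
  refine (rateAtLeast_of_gauge (Φ := holeGauge v l s)
    (C := b * max 1 (holeScale v l s) * max 1 (v l⁻¹)) hκ (by positivity) hstep
    (fun p => holeGauge_le_of_sum_le hb hl (hsum p)) ?_ hm (hA.trans_le h)).mono ?_
  · rw [Real.log_mul (by positivity) (by positivity), Real.log_mul (by positivity) (by positivity)]
    have h1 := Real.log_nonpos hκ.le hκ1
    have h2 := log_max_one_holeScale_le (v := v) (l := l) (s := s)
    have h3 := Real.posLog_eq_log_max_one (v.nonneg l⁻¹)
    have h4 : 0 ≤ Real.posLog (v l) := Real.posLog_nonneg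
    rw [baseError]
    linarith
  · rw [← hlogκ]
    have := Real.log_le_log hA h
    gcongr

theorem critOrbit_zero : critOrbit l s 0 = (-l, (1 + s) ^ 2) := rfl

theorem critOrbit_one_fst : (critOrbit l s 1).1 = -l ^ 2 * ((1 - l + s ^ 2) + 2 * s) := by
  rw [critOrbit_succ, critOrbit_zero, step]; ring

theorem le_holeGauge_zero : holeScale v l s * v l ≤ holeGauge v l s (critOrbit l s 0) :=
  le_max_of_le_right (by rw [critOrbit_zero, v.map_neg])

theorem le_holeGauge_one : holeScale v l s * (v l ^ 2 * v ((1 - l + s ^ 2) + 2 * s)) ≤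
    holeGauge v l s (critOrbit l s 1) :=
  le_max_of_le_right (by rw [critOrbit_one_fst, map_mul, v.map_neg, map_pow])

/-- The growth rate at an arbitrary place. If `1 - l + s ^ 2` is not much larger than `s`, the gauge
is applied to the starting point, and otherwise to its image. -/
theorem rateAtLeast_general (hl : l ≠ 0) (hs : s ≠ 0) :
    RateAtLeast v l s (Real.log 2 + baseError v l s)
      (Real.log (v s) + Real.log (v l) + Real.log (min 1 (v l)) - 2 * Real.log (5 / 2)) := by
  have hS := v.pos hs
  have hL := v.pos hl
  have hD := holeScale_pos v l hs
  have hμ : 0 < min 1 (v l) := lt_min one_pos hL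
  have hsum : ∀ p : K × K, v (p.1 + p.2) ≤ 2 * max (v p.1) (v p.2) := fun p =>
    (v.add_le _ _).trans (by linarith [le_max_left (v p.1) (v p.2), le_max_right (v p.1) (v p.2)])
  rcases le_total (v (1 - l + s ^ 2)) (5 / 2 * v s) with hd | hd
  · refine (rateAtLeast_of_holeGauge one_le_two (by norm_num) hl hs (holeGauge_step hl hs) hsum
      zero_le_two (by positivity) le_holeGauge_zero).mono ?_
    have h1 : holeScale v l s ≤ 5 / 2 * v s := max_le (by linarith) hd
    have h2 := Real.log_le_log hD h1
    rw [Real.log_mul (by norm_num) hS.ne'] at h2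
    rw [Real.log_mul hD.ne' hL.ne']
    linarith
  · have hDδ : holeScale v l s = v (1 - l + s ^ 2) := max_eq_right (by linarith)
    have h1 : holeScale v l s * (v l ^ 2 * (holeScale v l s / 5)) ≤
        holeGauge v l s (critOrbit l s 1) := by
      refine le_trans ?_ le_holeGauge_one
      gcongr
      have e : 1 - l + s ^ 2 = ((1 - l + s ^ 2) + 2 * s) - (s + s) := by ring
      have h2 : v (1 - l + s ^ 2) ≤ v ((1 - l + s ^ 2) + 2 * s) + (v s + v s) := by
        conv_lhs => rw [e]
        exact (v.sub_le_add _ _).trans (by gcongr; exact v.add_le _ _)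
      linarith
    refine (rateAtLeast_of_holeGauge one_le_two (by norm_num) hl hs (holeGauge_step hl hs) hsum
      one_le_two (by positivity) h1).mono ?_
    rw [Real.log_mul hD.ne' (by positivity), Real.log_mul (by positivity) (by positivity),
      Real.log_div hD.ne' (by norm_num), Real.log_pow]
    have h5 : Real.log 5 ≤ 3 * Real.log (5 / 2) := by
      rw [← Real.log_rpow (by norm_num)]
      exact Real.log_le_log (by norm_num) (by norm_num)
    have h6 : Real.log (min 1 (v l)) ≤ 0 := Real.log_nonpos hμ.le (min_le_left _ _)
    push_cast
    linarith

/-- The ultrametric form of `rateAtLeast_general`, without a loss. -/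
theorem rateAtLeast_general_nonarch (hv : IsNonarchimedean v) (hl : l ≠ 0) (hs : s ≠ 0) :
    RateAtLeast v l s (baseError v l s)
      (Real.log (v s) + Real.log (v l) + Real.log (min 1 (v l))) := by
  have hS := v.pos hs
  have hL := v.pos hl
  have hD := holeScale_pos v l hs
  have hμ : 0 < min 1 (v l) := lt_min one_pos hL
  have hsum : ∀ p : K × K, v (p.1 + p.2) ≤ 1 * max (v p.1) (v p.2) := fun p => by
    rw [one_mul]; exact hv _ _
  rw [show baseError v l s = Real.log 1 + baseError v l s by simp]
  rcases le_or_gt (v (1 - l + s ^ 2)) (v s) with hd | hd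
  · refine (rateAtLeast_of_holeGauge le_rfl le_rfl hl hs (holeGauge_step_nonarch hv hl hs) hsum
      zero_le_two (by positivity) le_holeGauge_zero).mono ?_
    have h1 : holeScale v l s = v s := max_eq_left hd
    rw [Real.log_mul hD.ne' hL.ne', h1, Real.log_one]
    linarith
  · have hDδ : holeScale v l s = v (1 - l + s ^ 2) := max_eq_right hd.le
    have h1 : holeScale v l s * (v l ^ 2 * holeScale v l s) ≤
        holeGauge v l s (critOrbit l s 1) := by
      refine le_trans ?_ le_holeGauge_one
      gcongr
      have e : 1 - l + s ^ 2 = ((1 - l + s ^ 2) + 2 * s) + -(s + s) := by ring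
      have h2 : v (1 - l + s ^ 2) ≤ max (v ((1 - l + s ^ 2) + 2 * s)) (v s) := by
        conv_lhs => rw [e]
        refine (hv _ _).trans (max_le_max_left _ ?_)
        rw [v.map_neg]
        exact (hv _ _).trans (max_self _).le
      rw [hDδ]
      exact (le_max_iff.mp h2).resolve_right (not_le.mpr hd)
    refine (rateAtLeast_of_holeGauge le_rfl le_rfl hl hs (holeGauge_step_nonarch hv hl hs) hsum
      one_le_two (by positivity) h1).mono ?_
    rw [Real.log_mul hD.ne' (by positivity), Real.log_mul (by positivity) (by positivity),
      Real.log_pow, Real.log_one]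
    have h6 : Real.log (min 1 (v l)) ≤ 0 := Real.log_nonpos hμ.le (min_le_left _ _)
    push_cast
    linarith

end HoleGauge

/-! ### Growth rates where `s` is large -/

section TailGauge

variable {K : Type*} [Field K] {v : AbsoluteValue K ℝ} {l s : K}

/-- The gauge `max |x| (|y| / |s|)`, used at places where `s` is large. -/
noncomputable def tailGauge (v : AbsoluteValue K ℝ) (s : K) (p : K × K) : ℝ :=
  max (v p.1) (v p.2 / v s)

/-- The estimate behind `tailGauge_step`, with `X = |x|`, `Y = |y|`, `e = |x + y|` and
`ε = |(1 - s ^ 2) * x + y|`. -/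
theorem tail_estimate {S L X Y e ε : ℝ} (hS : 16 ≤ S) (hL : 0 < L) (hLS : L ≤ S) (hX : 0 ≤ X)
    (hY : 0 ≤ Y) (he : 0 ≤ e) (hε : 0 ≤ ε) (h1 : X ≤ Y + e) (h2 : Y ≤ X + e)
    (h3 : S ^ 2 * X ≤ e + ε) (h4 : e ≤ S ^ 2 * X + ε) :
    L / 8 * max X (Y / S) ^ 2 ≤ max (L * X * e) (Y * ε / S) := by
  have hS0 : 0 < S := by linarith
  have hS2 : 256 ≤ S ^ 2 := by nlinarith
  suffices h : S ^ 2 / 8 * max X (Y / S) ^ 2 ≤ max (S ^ 2 * (X * e)) (Y * ε) by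
    have h' := mul_le_mul_of_nonneg_left h (div_nonneg hL.le (sq_nonneg S))
    have e1 : L / S ^ 2 * (S ^ 2 / 8 * max X (Y / S) ^ 2) = L / 8 * max X (Y / S) ^ 2 := by
      field_simp
    rw [e1, mul_max_of_nonneg _ _ (by positivity)] at h'
    refine h'.trans (max_le_max (le_of_eq (by field_simp)) ?_)
    rw [div_mul_eq_mul_div, div_le_div_iff₀ (by positivity) hS0]
    have : 0 ≤ Y * ε * S := by positivity
    nlinarith [mul_le_mul_of_nonneg_left hLS this]
  rcases le_total (Y / S) X with hc | hc
  · rw [max_eq_left hc]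
    rcases le_total (X / 8) e with hd | hd
    · refine le_max_of_le_left ?_
      have := mul_le_mul_of_nonneg_left hd (mul_nonneg (sq_nonneg S) hX)
      linarith
    · refine le_max_of_le_right ?_
      have hY' : 7 / 8 * X ≤ Y := by linarith
      have hε' : 1 / 2 * (S ^ 2 * X) ≤ ε := by nlinarith
      have := mul_le_mul hY' hε' (by positivity) hY
      nlinarith [mul_nonneg (sq_nonneg S) (sq_nonneg X)]
  · rw [max_eq_right hc, div_pow]
    have hXY : 16 * X ≤ Y := by
      rw [le_div_iff₀ hS0] at hc
      nlinarith
    have e1 : S ^ 2 / 8 * (Y ^ 2 / S ^ 2) = Y ^ 2 / 8 := by field_simp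
    rw [e1]
    rcases le_total (Y / 8) ε with hd | hd
    · refine le_max_of_le_right ?_
      nlinarith
    · refine le_max_of_le_left ?_
      have he' : 15 / 16 * Y ≤ e := by linarith
      have hX' : 3 / 4 * Y ≤ S ^ 2 * X := by linarith
      have := mul_le_mul hX' he' (by positivity) (by positivity)
      nlinarith

/-- The sharper ultrametric form of `tail_estimate`. -/
theorem tail_estimate_nonarch {S L X Y e ε : ℝ} (hS : 1 < S) (hL : 0 < L) (hLS : L ≤ S)
    (hX : 0 ≤ X) (hY : 0 ≤ Y) (he : 0 ≤ e) (hε : 0 ≤ ε) (h1 : X ≤ max Y e) (h2 : Y ≤ max X e)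
    (h3 : S ^ 2 * X ≤ max e ε) (h4 : e ≤ max (S ^ 2 * X) ε) :
    L / 1 * max X (Y / S) ^ 2 ≤ max (L * X * e) (Y * ε / S) := by
  have hS0 : 0 < S := by linarith
  have hS2 : 1 < S ^ 2 := one_lt_pow₀ hS two_ne_zero
  suffices h : S ^ 2 * max X (Y / S) ^ 2 ≤ max (S ^ 2 * (X * e)) (Y * ε) by
    have h' := mul_le_mul_of_nonneg_left h (div_nonneg hL.le (sq_nonneg S))
    have e1 : L / S ^ 2 * (S ^ 2 * max X (Y / S) ^ 2) = L / 1 * max X (Y / S) ^ 2 := by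
      field_simp
    rw [e1, mul_max_of_nonneg _ _ (by positivity)] at h'
    refine h'.trans (max_le_max (le_of_eq (by field_simp)) ?_)
    rw [div_mul_eq_mul_div, div_le_div_iff₀ (by positivity) hS0]
    have : 0 ≤ Y * ε * S := by positivity
    nlinarith [mul_le_mul_of_nonneg_left hLS this]
  rcases le_total (Y / S) X with hc | hc
  · rw [max_eq_left hc]
    rcases le_or_gt X e with hd | hd
    · refine le_max_of_le_left ?_
      nlinarith [mul_le_mul_of_nonneg_left hd (mul_nonneg (sq_nonneg S) hX)]
    · refine le_max_of_le_right ?_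
      have hY' : X ≤ Y := (le_max_iff.mp h1).resolve_right (not_le.mpr hd)
      have hX0 : 0 < X := he.trans_lt hd
      have hε' : S ^ 2 * X ≤ ε := by
        refine (le_max_iff.mp h3).resolve_left (not_le.mpr (hd.trans ?_))
        nlinarith
      have := mul_le_mul hY' hε' (by positivity) hY
      linarith
  · rw [max_eq_right hc, div_pow]
    have e1 : S ^ 2 * (Y ^ 2 / S ^ 2) = Y ^ 2 := by field_simp
    rw [e1]
    rcases le_or_gt Y ε with hd | hd
    · refine le_max_of_le_right ?_
      nlinarith
    · refine le_max_of_le_left ?_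
      have hY0 : 0 < Y := hε.trans_lt hd
      have hXY : X < Y := by
        rw [le_div_iff₀ hS0] at hc
        rcases hX.eq_or_lt with h | h
        · rwa [← h]
        · nlinarith
      have he' : Y ≤ e := (le_max_iff.mp h2).resolve_left (not_le.mpr hXY)
      have hX' : Y ≤ S ^ 2 * X := by
        rcases le_max_iff.mp h4 with h | h
        · exact he'.trans h
        · exact absurd (he'.trans h) (not_le.mpr hd)
      have := mul_le_mul hX' he' (by positivity) (by positivity)
      nlinarith

theorem map_step_snd (p : K × K) :
    v (step l s p).2 = v p.2 * v ((1 - s ^ 2) * p.1 + p.2) := by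
  simp only [step, map_mul]

theorem tailGauge_step (hl : l ≠ 0) (hS : 16 ≤ v s) (hLS : v l ≤ v s) (p : K × K) :
    v l / 8 * tailGauge v s p ^ 2 ≤ tailGauge v s (step l s p) := by
  rw [tailGauge, tailGauge, map_step_fst, map_step_snd]
  refine tail_estimate hS (v.pos hl) hLS (v.nonneg _) (v.nonneg _) (v.nonneg _) (v.nonneg _)
    ?_ ?_ ?_ ?_
  · calc v p.1 = v ((p.1 + p.2) - p.2) := by congr 1; ring
      _ ≤ v (p.1 + p.2) + v p.2 := v.sub_le_add _ _
      _ = _ := add_comm _ _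
  · calc v p.2 = v ((p.1 + p.2) - p.1) := by congr 1; ring
      _ ≤ v (p.1 + p.2) + v p.1 := v.sub_le_add _ _
      _ = _ := add_comm _ _
  · calc v s ^ 2 * v p.1 = v ((p.1 + p.2) - ((1 - s ^ 2) * p.1 + p.2)) := by
          rw [← map_pow, ← map_mul]; congr 1; ring
      _ ≤ _ := v.sub_le_add _ _
  · calc v (p.1 + p.2) = v (s ^ 2 * p.1 + ((1 - s ^ 2) * p.1 + p.2)) := by congr 1; ring
      _ ≤ v (s ^ 2 * p.1) + v ((1 - s ^ 2) * p.1 + p.2) := v.add_le _ _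
      _ = _ := by rw [map_mul, map_pow]

theorem tailGauge_step_nonarch (hv : IsNonarchimedean v) (hl : l ≠ 0) (hS : 1 < v s)
    (hLS : v l ≤ v s) (p : K × K) :
    v l / 1 * tailGauge v s p ^ 2 ≤ tailGauge v s (step l s p) := by
  rw [tailGauge, tailGauge, map_step_fst, map_step_snd]
  refine tail_estimate_nonarch hS (v.pos hl) hLS (v.nonneg _) (v.nonneg _) (v.nonneg _)
    (v.nonneg _) ?_ ?_ ?_ ?_
  · calc v p.1 = v (-p.2 + (p.1 + p.2)) := by congr 1; ring
      _ ≤ max (v (-p.2)) (v (p.1 + p.2)) := hv _ _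
      _ = _ := by rw [v.map_neg]
  · calc v p.2 = v (-p.1 + (p.1 + p.2)) := by congr 1; ring
      _ ≤ max (v (-p.1)) (v (p.1 + p.2)) := hv _ _
      _ = _ := by rw [v.map_neg]
  · calc v s ^ 2 * v p.1 = v ((p.1 + p.2) + -((1 - s ^ 2) * p.1 + p.2)) := by
          rw [← map_pow, ← map_mul]; congr 1; ring
      _ ≤ max (v (p.1 + p.2)) (v (-((1 - s ^ 2) * p.1 + p.2))) := hv _ _
      _ = _ := by rw [v.map_neg]
  · calc v (p.1 + p.2) = v (s ^ 2 * p.1 + ((1 - s ^ 2) * p.1 + p.2)) := by congr 1; ring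
      _ ≤ max (v (s ^ 2 * p.1)) (v ((1 - s ^ 2) * p.1 + p.2)) := hv _ _
      _ = _ := by rw [map_mul, map_pow]

theorem rateAtLeast_of_tailGauge {c A E : ℝ} (hc : 1 ≤ c) (hl : l ≠ 0) (hS : 1 ≤ v s)
    (hstep : ∀ p : K × K, v l / c * tailGauge v s p ^ 2 ≤ tailGauge v s (step l s p))
    (hE : baseError v l s ≤ E) {m : ℕ} (hm : m ≤ 2) (hA : 0 < A)
    (h : A * v s ≤ v (critOrbit l s m).2) :
    RateAtLeast v l s E ((Real.log A + (Real.log (v l) - Real.log c)) / 2 ^ m) := by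
  have hL := v.pos hl
  have hS0 : 0 < v s := one_pos.trans_le hS
  have hc0 : 0 < c := one_pos.trans_le hc
  have hA' : A ≤ tailGauge v s (critOrbit l s m) :=
    le_max_of_le_right ((le_div_iff₀ hS0).mpr h)
  refine (rateAtLeast_of_gauge (Φ := tailGauge v s) (C := max 1 (v l⁻¹)) (div_pos hL hc0)
    (by positivity) hstep (fun p => max_le (fst_le hl p) ?_) ?_ hm (hA.trans_le hA')).mono ?_
  · exact (div_le_self (v.nonneg _) hS).trans (snd_le p)
  · refine le_trans ?_ hE
    rw [Real.log_div hL.ne' hc0.ne', ← Real.posLog_eq_log_max_one (v.nonneg _), baseError]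
    have h1 : Real.log (v l) ≤ Real.posLog (v l) := le_max_right _ _
    have h2 := Real.log_nonneg hc
    have h3 : 0 ≤ Real.posLog (v s) := Real.posLog_nonneg
    have h4 : 0 ≤ Real.posLog (v (1 - l + s ^ 2)) := Real.posLog_nonneg
    linarith
  · rw [Real.log_div hL.ne' hc0.ne']
    have := Real.log_le_log hA hA'
    gcongr

theorem critOrbit_one_snd :
    (critOrbit l s 1).2 = (1 + s) ^ 3 * ((1 + l) * (1 + s) - 2 * l) := by
  rw [critOrbit_succ, critOrbit_zero, step]; ring

theorem critOrbit_two_snd :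
    (critOrbit (-1) s 2).2 = s * (2 * (1 + s) ^ 3 * (4 + 7 * s + 4 * s ^ 2 + s ^ 3)) := by
  rw [critOrbit_succ, critOrbit_succ, critOrbit_zero]; simp only [step]; ring

end TailGauge

/-! ### The local lower bound -/

section LocalBound

variable {K : Type*} [Field K] {v : AbsoluteValue K ℝ} {l s : K}

/-- The lower bound for the growth rate that is summed over all places. -/
noncomputable def localRate (v : AbsoluteValue K ℝ) (l s κ : K) : ℝ :=
  Real.log (v s) + 1 / 8 * Real.posLog (v s) + 1 / 16 * Real.log (v κ) + 1 / 2 * Real.log (v l)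
    - 3 / 2 * Real.posLog (v l⁻¹)

/-- The loss in the local bound at an archimedean place. Half of it is the constant that the sum of
the local bounds contributes to the canonical height of the critical point. -/
noncomputable def archLoss : ℝ := 23 / 8 * Real.log 2 + 3 / 8 * Real.log 3

theorem log_min_one_eq {x : ℝ} (hx : 0 < x) : Real.log (min 1 x) = min 0 (Real.log x) := by
  rcases le_total 1 x with h | h
  · rw [min_eq_left h, Real.log_one, min_eq_left (Real.log_nonneg h)]
  · rw [min_eq_right h, min_eq_right (Real.log_nonpos hx.le h)]

theorem posLog_inv_eq : Real.posLog (v l⁻¹) = max 0 (-Real.log (v l)) := by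
  rw [map_inv₀, Real.posLog, Real.log_inv]

/-- The general bound for the growth rate is at least the bound to be proved, as soon as
`|s| ^ 2 * |κ|` is controlled by `|l|`. -/
theorem localRate_le_general {κ : K} {C : ℝ} (hl : l ≠ 0)
    (h : Real.posLog (v s) + 1 / 2 * Real.log (v κ) ≤ 4 * max 0 (Real.log (v l)) + 8 * C) :
    localRate v l s κ - C ≤
      Real.log (v s) + Real.log (v l) + Real.log (min 1 (v l)) := by
  rw [localRate, log_min_one_eq (v.pos hl), posLog_inv_eq]
  rcases le_total 0 (Real.log (v l)) with hb | hb
  · rw [max_eq_right hb] at h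
    rw [min_eq_left hb, max_eq_left (by linarith)]
    linarith
  · rw [max_eq_left hb] at h
    rw [min_eq_right hb, max_eq_right (by linarith)]
    linarith

/-- Interpolation of the general bound with a bound from the tail gauge. -/
theorem localRate_le_convex {κ : K} {C₀ C₁ g : ℝ} (hl : l ≠ 0) (hS : 1 ≤ v s)
    (h : 3 / 2 * Real.log (v s) + 1 / 4 * Real.log (v κ) +
      1 / 2 * min 0 (Real.log (v l)) - C₁ ≤ g) :
    localRate v l s κ - (3 / 4 * C₀ + 1 / 4 * C₁) ≤
      3 / 4 * (Real.log (v s) + Real.log (v l) + Real.log (min 1 (v l)) - C₀) + 1 / 4 * g := by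
  have ha : 0 ≤ Real.log (v s) := Real.log_nonneg hS
  rw [localRate, log_min_one_eq (v.pos hl), posLog_inv_eq, Real.posLog, max_eq_right ha]
  rcases le_total 0 (Real.log (v l)) with hb | hb
  · rw [min_eq_left hb] at h
    rw [min_eq_left hb, max_eq_left (by linarith)]
    linarith
  · rw [min_eq_right hb] at h
    rw [min_eq_right hb, max_eq_right (by linarith)]
    linarith

theorem archLoss_ge : 2 * Real.log (5 / 2) + 3 / 4 * Real.log 2 ≤ archLoss ∧
    3 / 2 * Real.log (5 / 2) + 5 / 4 * Real.log 2 ≤ archLoss := by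
  have h1 : 9 * Real.log 2 ≤ 6 * Real.log 3 := by
    rw [← Real.log_rpow two_pos, ← Real.log_rpow three_pos]
    exact Real.log_le_log (by positivity) (by norm_num)
  have h2 : 32 * Real.log (5 / 2) ≤ 43 * Real.log 2 := by
    rw [← Real.log_rpow two_pos, ← Real.log_rpow (by norm_num)]
    exact Real.log_le_log (by positivity) (by norm_num)
  have h3 : 0 ≤ Real.log 2 := Real.log_nonneg one_le_two
  rw [archLoss]
  constructor <;> linarith

theorem log_two_pow_eq (n : ℕ) : Real.log (2 ^ n) = n * Real.log 2 := Real.log_pow _ _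

/-- The local bound at an arbitrary place for `l ≠ -1`. The general bound suffices unless
`s * (1 + l)` is large compared with `l`; then the second coordinate of the image of the starting
point is large, and the tail gauge applies to this image. -/
theorem rateAtLeast_arch (hl : l ≠ 0) (hs : s ≠ 0) (hl1 : 1 + l ≠ 0) :
    RateAtLeast v l s (Real.log 2 + baseError v l s)
      (localRate v l s ((1 + l) ^ 2) - archLoss) := by
  have hS := v.pos hs
  have hL := v.pos hl
  have hU := v.pos hl1
  have hlog2 : 0 ≤ Real.log 2 := Real.log_nonneg one_le_two
  obtain ⟨hc1, hc2⟩ := archLoss_ge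
  have hgen := rateAtLeast_general (v := v) hl hs
  have hκ : Real.log (v ((1 + l) ^ 2)) = 2 * Real.log (v (1 + l)) := by
    rw [map_pow, Real.log_pow]; norm_num
  have hu : Real.log (v (1 + l)) ≤ Real.log 2 + max 0 (Real.log (v l)) := by
    have h1 : v (1 + l) ≤ 2 * max 1 (v l) := by
      have := v.add_le 1 l
      rw [v.map_one] at this
      linarith [le_max_left 1 (v l), le_max_right 1 (v l)]
    have h2 := Real.log_le_log hU h1
    rwa [Real.log_mul two_ne_zero (by positivity), ← Real.posLog_eq_log_max_one hL.le] at h2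
  have hmax0 : 0 ≤ max 0 (Real.log (v l)) := le_max_left _ _
  have hmaxL : Real.log (v l) ≤ max 0 (Real.log (v l)) := le_max_right _ _
  -- it is enough that `s * (1 + l)` is not large compared with `l`
  have easy : Real.posLog (v s) + Real.log (v (1 + l)) ≤
      6 * Real.log 2 + 4 * max 0 (Real.log (v l)) →
      RateAtLeast v l s (Real.log 2 + baseError v l s)
        (localRate v l s ((1 + l) ^ 2) - archLoss) := fun h => by
    have := localRate_le_general (v := v) (s := s) (κ := (1 + l) ^ 2)
      (C := archLoss - 2 * Real.log (5 / 2)) hl (by rw [hκ]; linarith)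
    exact hgen.mono (by linarith)
  rcases le_or_gt (v s) 16 with hS16 | hS16
  · refine easy ?_
    have h1 : Real.log (v s) ≤ 4 * Real.log 2 := by
      have := Real.log_le_log hS hS16
      rw [show (16 : ℝ) = 2 ^ 4 by norm_num, log_two_pow_eq] at this
      exact_mod_cast this
    have h2 : Real.posLog (v s) ≤ 4 * Real.log 2 := max_le (by positivity) h1
    linarith
  have ha : 0 ≤ Real.log (v s) := Real.log_nonneg (by linarith)
  have hpa : Real.posLog (v s) = Real.log (v s) := max_eq_right ha
  rcases le_or_gt (v s) (v l) with hLS | hLS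
  · refine easy ?_
    have := Real.log_le_log hS hLS
    linarith
  have hσ : 15 / 16 * v s ≤ v (1 + s) := by
    have h1 : v s ≤ v (1 + s) + v 1 := by
      calc v s = v ((1 + s) - 1) := by congr 1; ring
        _ ≤ _ := v.sub_le_add _ _
    rw [v.map_one] at h1
    linarith
  rcases le_or_gt (v (1 + l) * v (1 + s)) (4 * v l) with hτ | hτ
  · refine easy ?_
    have h1 : v (1 + l) * v s ≤ 2 ^ 3 * v l := by nlinarith
    have h2 := Real.log_le_log (by positivity) h1
    rw [Real.log_mul hU.ne' hS.ne', Real.log_mul (by norm_num) hL.ne', log_two_pow_eq] at h2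
    push_cast at h2
    linarith
  · have hτ' : v (1 + l) * v (1 + s) / 2 ≤ v ((1 + l) * (1 + s) - 2 * l) := by
      have h1 : v ((1 + l) * (1 + s)) ≤
          v ((1 + l) * (1 + s) - 2 * l) + (v l + v l) := by
        calc v ((1 + l) * (1 + s)) = v (((1 + l) * (1 + s) - 2 * l) + (l + l)) := by
              congr 1; ring
          _ ≤ _ := (v.add_le _ _).trans (by gcongr; exact v.add_le _ _)
      rw [map_mul] at h1
      linarith
    have hA : v s ^ 3 * v (1 + l) / 2 ^ 2 * v s ≤ v (critOrbit l s 1).2 := by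
      rw [critOrbit_one_snd, map_mul, map_pow]
      have h1 : (15 / 16 * v s) ^ 4 ≤ v (1 + s) ^ 4 := pow_le_pow_left₀ (by positivity) hσ 4
      have h2 : v (1 + s) ^ 3 * (v (1 + l) * v (1 + s) / 2) ≤
          v (1 + s) ^ 3 * v ((1 + l) * (1 + s) - 2 * l) := by gcongr
      refine le_trans ?_ h2
      have h3 := mul_le_mul_of_nonneg_right h1 hU.le
      have h4 : 0 ≤ v s ^ 4 * v (1 + l) := by positivity
      nlinarith
    have htail := rateAtLeast_of_tailGauge (c := 8) (E := Real.log 2 + baseError v l s)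
      (by norm_num) hl (by linarith) (tailGauge_step hl hS16.le hLS.le) (by linarith) one_le_two
      (by positivity) hA
    refine (hgen.convex htail).mono (le_trans ?_ (localRate_le_convex (κ := (1 + l) ^ 2)
      (C₀ := 2 * Real.log (5 / 2)) (C₁ := 5 / 2 * Real.log 2) hl (by linarith) ?_))
    · linarith
    · rw [hκ, Real.log_div (by positivity) (by positivity), Real.log_mul (by positivity) hU.ne',
        Real.log_pow, log_two_pow_eq, show (8 : ℝ) = 2 ^ 3 by norm_num, log_two_pow_eq]
      have := min_le_right 0 (Real.log (v l))
      push_cast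
      linarith

/-- The ultrametric form of `rateAtLeast_arch`, without a loss. -/
theorem rateAtLeast_nonarch (hv : IsNonarchimedean v) (hl : l ≠ 0) (hs : s ≠ 0)
    (hl1 : 1 + l ≠ 0) :
    RateAtLeast v l s (baseError v l s) (localRate v l s ((1 + l) ^ 2)) := by
  have hS := v.pos hs
  have hL := v.pos hl
  have hU := v.pos hl1
  have hgen := rateAtLeast_general_nonarch hv hl hs
  have hκ : Real.log (v ((1 + l) ^ 2)) = 2 * Real.log (v (1 + l)) := by
    rw [map_pow, Real.log_pow]; norm_num
  have hu : Real.log (v (1 + l)) ≤ max 0 (Real.log (v l)) := by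
    have h1 : v (1 + l) ≤ max 1 (v l) := by
      have := hv 1 l
      rwa [v.map_one] at this
    have h2 := Real.log_le_log hU h1
    rwa [← Real.posLog_eq_log_max_one hL.le] at h2
  have hmax0 : 0 ≤ max 0 (Real.log (v l)) := le_max_left _ _
  have hmaxL : Real.log (v l) ≤ max 0 (Real.log (v l)) := le_max_right _ _
  have easy : Real.posLog (v s) + Real.log (v (1 + l)) ≤ 4 * max 0 (Real.log (v l)) →
      RateAtLeast v l s (baseError v l s) (localRate v l s ((1 + l) ^ 2)) := fun h => by
    have := localRate_le_general (v := v) (s := s) (κ := (1 + l) ^ 2)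
      (C := 0) hl (by rw [hκ]; linarith)
    exact hgen.mono (by linarith)
  rcases le_or_gt (v s) 1 with hS1 | hS1
  · refine easy ?_
    have h2 : Real.posLog (v s) ≤ 0 := max_le le_rfl (Real.log_nonpos hS.le hS1)
    linarith
  have ha : 0 ≤ Real.log (v s) := Real.log_nonneg hS1.le
  have hpa : Real.posLog (v s) = Real.log (v s) := max_eq_right ha
  rcases le_or_gt (v s) (v l) with hLS | hLS
  · refine easy ?_
    have := Real.log_le_log hS hLS
    linarith
  have hσ : v s ≤ v (1 + s) := by
    have h1 : v s ≤ max (v (1 + s)) (v (-1)) := by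
      calc v s = v ((1 + s) + -1) := by congr 1; ring
        _ ≤ _ := hv _ _
    rw [v.map_neg, v.map_one] at h1
    exact (le_max_iff.mp h1).resolve_right (not_le.mpr hS1)
  rcases le_or_gt (v (1 + l) * v s) (v l) with hτ | hτ
  · refine easy ?_
    have h2 := Real.log_le_log (by positivity) hτ
    rw [Real.log_mul hU.ne' hS.ne'] at h2
    linarith
  · have hτ' : v (1 + l) * v s ≤ v ((1 + l) * (1 + s) - 2 * l) := by
      have h1 : v (1 + l) * v s ≤ max (v ((1 + l) * (1 + s) - 2 * l)) (v l) := by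
        calc v (1 + l) * v s ≤ v (1 + l) * v (1 + s) := by gcongr
          _ = v (((1 + l) * (1 + s) - 2 * l) + (l + l)) := by rw [← map_mul]; congr 1; ring
          _ ≤ _ := (hv _ _).trans (max_le_max_left _ ((hv _ _).trans (max_self _).le))
      exact (le_max_iff.mp h1).resolve_right (not_le.mpr hτ)
    have hA : v s ^ 3 * v (1 + l) * v s ≤ v (critOrbit l s 1).2 := by
      rw [critOrbit_one_snd, map_mul, map_pow, mul_assoc]
      gcongr
    have htail := rateAtLeast_of_tailGauge (c := 1) (E := baseError v l s)
      le_rfl hl hS1.le (tailGauge_step_nonarch hv hl hS1 hLS.le) le_rfl one_le_two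
      (by positivity) hA
    have key := localRate_le_convex (v := v) (l := l) (s := s) (κ := (1 + l) ^ 2) (C₀ := 0)
      (C₁ := 0) hl hS1.le (g := (Real.log (v s ^ 3 * v (1 + l)) +
        (Real.log (v l) - Real.log 1)) / 2 ^ 1) (by
      rw [hκ, Real.log_mul (by positivity) hU.ne', Real.log_pow, Real.log_one]
      have := min_le_right 0 (Real.log (v l))
      push_cast
      linarith)
    exact (hgen.convex htail).mono (by linarith)

/-- The local bound at an arbitrary place for `l = -1`. Here the leading term of the second
coordinate of the image of the starting point vanishes, and the tail gauge is applied one step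
later. -/
theorem rateAtLeast_neg_one_arch (h2 : (2 : K) ≠ 0) (hs : s ≠ 0) :
    RateAtLeast v (-1) s (Real.log 2 + baseError v (-1) s)
      (localRate v (-1) s 2 - archLoss) := by
  have hS := v.pos hs
  have hU := v.pos h2
  have hl : (-1 : K) ≠ 0 := neg_ne_zero.mpr one_ne_zero
  have hL : v (-1) = 1 := by rw [v.map_neg, v.map_one]
  have hlog2 : 0 ≤ Real.log 2 := Real.log_nonneg one_le_two
  obtain ⟨hc1, hc2⟩ := archLoss_ge
  have hgen := rateAtLeast_general (v := v) hl hs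
  have hnat : ∀ n : ℕ, v (n : K) ≤ n := fun n => by
    induction n with
    | zero => simp
    | succ n ih =>
      push_cast
      refine (v.add_le _ _).trans ?_
      rw [v.map_one]
      linarith
  rcases le_or_gt (v s) 16 with hS16 | hS16
  · have h1 : Real.log (v s) ≤ 4 * Real.log 2 := by
      have := Real.log_le_log hS hS16
      rw [show (16 : ℝ) = 2 ^ 4 by norm_num, log_two_pow_eq] at this
      exact_mod_cast this
    have h3 : Real.posLog (v s) ≤ 4 * Real.log 2 := max_le (by positivity) h1
    have h4 : Real.log (v 2) ≤ Real.log 2 := Real.log_le_log hU (by exact_mod_cast hnat 2)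
    have := localRate_le_general (v := v) (s := s) (κ := 2)
      (C := archLoss - 2 * Real.log (5 / 2)) hl (by rw [hL, Real.log_one, max_self]; linarith)
    exact hgen.mono (by linarith)
  · have hσ : 15 / 16 * v s ≤ v (1 + s) := by
      have h1 : v s ≤ v (1 + s) + v 1 := by
        calc v s = v ((1 + s) - 1) := by congr 1; ring
          _ ≤ _ := v.sub_le_add _ _
      rw [v.map_one] at h1
      linarith
    have hq : 1 / 2 * v s ^ 3 ≤ v (4 + 7 * s + 4 * s ^ 2 + s ^ 3) := by
      have h1 : v (s ^ 3) ≤ v (4 + 7 * s + 4 * s ^ 2 + s ^ 3) + v (4 + 7 * s + 4 * s ^ 2) := by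
        calc v (s ^ 3) = v ((4 + 7 * s + 4 * s ^ 2 + s ^ 3) - (4 + 7 * s + 4 * s ^ 2)) := by
              congr 1; ring
          _ ≤ _ := v.sub_le_add _ _
      have h4 : v (4 : K) ≤ 4 := by exact_mod_cast hnat 4
      have h7 : v (7 : K) ≤ 7 := by exact_mod_cast hnat 7
      have h3 : v (4 + 7 * s + 4 * s ^ 2) ≤ 4 + 7 * v s + 4 * v s ^ 2 := by
        refine (v.add_le _ _).trans (add_le_add ((v.add_le _ _).trans (add_le_add h4 ?_)) ?_)
        · rw [map_mul]; gcongr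
        · rw [map_mul, map_pow]; gcongr
      rw [map_pow] at h1
      have h5 : 16 * v s ^ 2 ≤ v s ^ 3 := by nlinarith [sq_nonneg (v s)]
      have h6 : 16 * v s ≤ v s ^ 2 := by nlinarith
      nlinarith
    have hA : v 2 * v s ^ 6 / 2 ^ 2 * v s ≤ v (critOrbit (-1) s 2).2 := by
      rw [critOrbit_two_snd, map_mul, map_mul, map_mul, map_pow v (1 + s)]
      have h1 : 1 / 2 * v s ^ 3 ≤ v (1 + s) ^ 3 := by
        have := pow_le_pow_left₀ (by positivity) hσ 3
        have h0 : 0 ≤ v s ^ 3 := by positivity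
        nlinarith
      have h3 := mul_le_mul h1 hq (by positivity) (by positivity)
      have h4 := mul_le_mul_of_nonneg_left h3 (by positivity : 0 ≤ v s * v 2)
      nlinarith
    have htail := rateAtLeast_of_tailGauge (c := 8) (E := Real.log 2 + baseError v (-1) s)
      (by norm_num) hl (by linarith) (tailGauge_step hl hS16.le (by rw [hL]; linarith))
      (by linarith) le_rfl (by positivity) hA
    refine (hgen.convex htail).mono (le_trans ?_ (localRate_le_convex (κ := 2)
      (C₀ := 2 * Real.log (5 / 2)) (C₁ := 5 / 4 * Real.log 2) hl (by linarith) ?_))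
    · linarith
    · rw [Real.log_div (by positivity) (by positivity), Real.log_mul hU.ne' (by positivity),
        Real.log_pow, log_two_pow_eq, show (8 : ℝ) = 2 ^ 3 by norm_num, log_two_pow_eq, hL,
        Real.log_one, min_self]
      push_cast
      linarith

/-- The ultrametric form of `rateAtLeast_neg_one_arch`, without a loss. -/
theorem rateAtLeast_neg_one_nonarch (hv : IsNonarchimedean v) (h2 : (2 : K) ≠ 0) (hs : s ≠ 0) :
    RateAtLeast v (-1) s (baseError v (-1) s) (localRate v (-1) s 2) := by
  have hS := v.pos hs
  have hU := v.pos h2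
  have hl : (-1 : K) ≠ 0 := neg_ne_zero.mpr one_ne_zero
  have hL : v (-1) = 1 := by rw [v.map_neg, v.map_one]
  have hgen := rateAtLeast_general_nonarch hv hl hs
  have hnat : ∀ n : ℤ, v (n : K) ≤ 1 := fun n => IsNonarchimedean.apply_intCast_le_one hv
  rcases le_or_gt (v s) 1 with hS1 | hS1
  · have h3 : Real.posLog (v s) ≤ 0 := max_le le_rfl (Real.log_nonpos hS.le hS1)
    have h4 : Real.log (v 2) ≤ 0 := Real.log_nonpos hU.le (by exact_mod_cast hnat 2)
    have := localRate_le_general (v := v) (s := s) (κ := 2)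
      (C := 0) hl (by rw [hL, Real.log_one, max_self]; linarith)
    exact hgen.mono (by linarith)
  · have hσ : v s ≤ v (1 + s) := by
      have h1 : v s ≤ max (v (1 + s)) (v (-1)) := by
        calc v s = v ((1 + s) + -1) := by congr 1; ring
          _ ≤ _ := hv _ _
      rw [hL] at h1
      exact (le_max_iff.mp h1).resolve_right (not_le.mpr hS1)
    have hq : v s ^ 3 ≤ v (4 + 7 * s + 4 * s ^ 2 + s ^ 3) := by
      have h1 : v (s ^ 3) ≤ max (v (4 + 7 * s + 4 * s ^ 2 + s ^ 3))
          (v (-(4 + 7 * s + 4 * s ^ 2))) := by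
        calc v (s ^ 3) = v ((4 + 7 * s + 4 * s ^ 2 + s ^ 3) + -(4 + 7 * s + 4 * s ^ 2)) := by
              congr 1; ring
          _ ≤ _ := hv _ _
      have h4 : v (4 : K) ≤ 1 := by exact_mod_cast hnat 4
      have h7 : v (7 : K) ≤ 1 := by exact_mod_cast hnat 7
      have hlt : v s < v s ^ 2 := by nlinarith
      have h3 : v (4 + 7 * s + 4 * s ^ 2) ≤ v s ^ 2 := by
        refine (hv _ _).trans (max_le ((hv _ _).trans (max_le ?_ ?_)) ?_)
        · linarith
        · rw [map_mul]
          exact (mul_le_of_le_one_left hS.le h7).trans hlt.le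
        · rw [map_mul, map_pow]
          exact mul_le_of_le_one_left (by positivity) h4
      rw [v.map_neg, map_pow] at h1
      refine (le_max_iff.mp h1).resolve_right (not_le.mpr (h3.trans_lt ?_))
      exact pow_lt_pow_right₀ hS1 (by norm_num)
    have hA : v 2 * v s ^ 6 * v s ≤ v (critOrbit (-1) s 2).2 := by
      rw [critOrbit_two_snd, map_mul, map_mul, map_mul, map_pow v (1 + s)]
      have h1 : v s ^ 3 ≤ v (1 + s) ^ 3 := pow_le_pow_left₀ hS.le hσ 3
      have h3 := mul_le_mul h1 hq (by positivity) (by positivity)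
      have h4 := mul_le_mul_of_nonneg_left h3 (by positivity : 0 ≤ v s * v 2)
      linarith
    have htail := rateAtLeast_of_tailGauge (c := 1) (E := baseError v (-1) s)
      le_rfl hl hS1.le (tailGauge_step_nonarch hv hl hS1 (by rw [hL]; exact hS1.le)) le_rfl le_rfl
      (by positivity) hA
    have key := localRate_le_convex (v := v) (l := -1) (s := s) (κ := 2) (C₀ := 0)
      (C₁ := 0) hl hS1.le (g := (Real.log (v 2 * v s ^ 6) +
        (Real.log (v (-1)) - Real.log 1)) / 2 ^ 2) (by
      rw [Real.log_mul hU.ne' (by positivity), Real.log_pow, hL, Real.log_one, min_self]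
      push_cast
      linarith)
    exact (hgen.convex htail).mono (by linarith)

/-- The local bound, with the auxiliary element `(1 + l) ^ 2`, or `2` if `l = -1`. -/
theorem exists_rateAtLeast [CharZero K] (hl : l ≠ 0) (hs : s ≠ 0) : ∃ κ : K, κ ≠ 0 ∧
    (∀ v : AbsoluteValue K ℝ, RateAtLeast v l s (Real.log 2 + baseError v l s)
      (localRate v l s κ - archLoss)) ∧
    ∀ v : AbsoluteValue K ℝ, IsNonarchimedean v →
      RateAtLeast v l s (baseError v l s) (localRate v l s κ) := by
  by_cases hl1 : 1 + l = 0
  · obtain rfl : l = -1 := by linear_combination hl1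
    exact ⟨2, two_ne_zero, fun v => rateAtLeast_neg_one_arch two_ne_zero hs,
      fun v hv => rateAtLeast_neg_one_nonarch hv two_ne_zero hs⟩
  · exact ⟨(1 + l) ^ 2, pow_ne_zero 2 hl1, fun v => rateAtLeast_arch hl hs hl1,
      fun v hv => rateAtLeast_nonarch hv hl hs hl1⟩

end LocalBound

/-! ### The global lower bound and the canonical height -/

section GlobalBound

open Height.AdmissibleAbsValues

variable {K : Type*} [Field K] [CharZero K] [AdmissibleAbsValues K]

/-- The sum of the local bounds. The terms `log |s|`, `log |κ|` and `log |l|` drop out by the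
product formula. -/
theorem logHeight₁_critOrbit_ge {l s : K} (hl : l ≠ 0) (hs : s ≠ 0) :
    ∃ E : ℝ, ∀ n ≥ 2, 2 ^ n * (1 / 8 * logHeight₁ s - 3 / 2 * logHeight₁ l -
      totalWeight K * archLoss) - E ≤
        logHeight₁ (l * (critOrbit l s n).1 / (critOrbit l s n).2) := by
  obtain ⟨κ, hκ, harch, hnon⟩ := exists_rateAtLeast hl hs
  have fs := finitelySupported_log hs
  have fκ := finitelySupported_log hκ
  have fl := finitelySupported_log hl
  have ps := finitelySupported_posLog s
  have pd := finitelySupported_posLog (1 - l + s ^ 2)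
  have pl := finitelySupported_posLog l
  have pli := finitelySupported_posLog l⁻¹
  have frate : FinitelySupported fun v => localRate v l s κ := by
    have := (((fs.add (ps.const_mul (1 / 8))).add (fκ.const_mul (1 / 16))).add
      (fl.const_mul (1 / 2))).add (pli.const_mul (-(3 / 2)))
    simpa only [localRate, sub_eq_add_neg, neg_mul] using this
  have srate : placeSum (fun v => localRate v l s κ) =
      1 / 8 * logHeight₁ s - 3 / 2 * logHeight₁ l := by
    have : (fun v => localRate v l s κ) = fun v : AbsoluteValue K ℝ =>
        (((Real.log (v s) + 1 / 8 * Real.posLog (v s)) + 1 / 16 * Real.log (v κ)) +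
          1 / 2 * Real.log (v l)) + -(3 / 2) * Real.posLog (v l⁻¹) := by
      funext v; rw [localRate]; ring
    rw [this, placeSum_add (((fs.add (ps.const_mul _)).add (fκ.const_mul _)).add
        (fl.const_mul _)) (pli.const_mul _),
      placeSum_add ((fs.add (ps.const_mul _)).add (fκ.const_mul _)) (fl.const_mul _),
      placeSum_add (fs.add (ps.const_mul _)) (fκ.const_mul _),
      placeSum_add fs (ps.const_mul _), placeSum_const_mul, placeSum_const_mul,
      placeSum_const_mul, placeSum_const_mul, placeSum_log hs, placeSum_log hκ, placeSum_log hl,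
      placeSum_posLog, placeSum_posLog, logHeight₁_inv]
    ring
  have ferr : FinitelySupported fun v => baseError v l s := ((ps.add pd).add pl).add pli
  refine ⟨placeSum (fun v => baseError v l s) + totalWeight K * Real.log 2, fun n hn => ?_⟩
  have hne : l * (critOrbit l s n).1 ≠ 0 ∨ (critOrbit l s n).2 ≠ 0 := by
    by_contra! h
    exact critOrbit_ne_zero hl hs n
      (Prod.ext ((mul_eq_zero.mp h.1).resolve_left hl) h.2)
  have key := placeSum_le ((frate.const_mul (2 ^ n)).add (ferr.const_mul (-1)))
    (finitelySupported_log_max hne) (2 ^ n * archLoss + Real.log 2)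
    (fun v _ => by linarith [harch v n hn])
    (fun v hv => by linarith [hnon v (isNonarchimedean v hv) n hn])
  rw [placeSum_add (frate.const_mul _) (ferr.const_mul _), placeSum_const_mul, placeSum_const_mul,
    srate, placeSum_log_max hne] at key
  linarith

end GlobalBound

section Forms

variable {K : Type*} [Field K]

/-- The forms of the quadratic map on pairs of homogeneous coordinates over a subfield. -/
def quadMap (l li : K) (p : Fin 2 → K) : Fin 2 → K :=
  ![l * (p 0 * p 1) + p 0 ^ 2, li * (p 0 * p 1) + p 1 ^ 2]

open MvPolynomial in
/-- The forms of `quadMap` as polynomials. -/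
noncomputable def quadForm (l li : K) : Fin 2 → MvPolynomial (Fin 2) K :=
  ![C l * (X 0 * X 1) + X 0 ^ 2, C li * (X 0 * X 1) + X 1 ^ 2]

open MvPolynomial in
/-- Linear forms that express multiples of `x ^ 3` and `y ^ 3` in terms of `quadForm`. -/
noncomputable def quadCofactor (l li : K) : Fin 2 × Fin 2 → MvPolynomial (Fin 2) K :=
  Function.uncurry ![
    ![X 0 - C (l / (1 - l * li)) * X 1, C (l ^ 2 / (1 - l * li)) * X 0],
    ![C (li ^ 2 / (1 - l * li)) * X 1, X 1 - C (li / (1 - l * li)) * X 0]]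

open MvPolynomial in
theorem quadForm_isHomogeneous (l li : K) (i : Fin 2) : (quadForm l li i).IsHomogeneous 2 := by
  have hXX : (X 0 * X 1 : MvPolynomial (Fin 2) K).IsHomogeneous 2 :=
    (isHomogeneous_X K 0).mul (isHomogeneous_X K 1)
  fin_cases i
  · exact (hXX.C_mul l).add (isHomogeneous_X_pow 0 2)
  · exact (hXX.C_mul li).add (isHomogeneous_X_pow 1 2)

open MvPolynomial in
theorem quadCofactor_isHomogeneous (l li : K) (a : Fin 2 × Fin 2) :
    (quadCofactor l li a).IsHomogeneous 1 := by
  have h0 := isHomogeneous_X K (0 : Fin 2)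
  have h1 := isHomogeneous_X K (1 : Fin 2)
  obtain ⟨i, j⟩ := a
  fin_cases i <;> fin_cases j
  · exact h0.sub (h1.C_mul _)
  · exact h0.C_mul _
  · exact h1.C_mul _
  · exact h1.sub (h0.C_mul _)

theorem eval_quadForm (l li : K) (p : Fin 2 → K) :
    (fun j => MvPolynomial.eval p (quadForm l li j)) = quadMap l li p := by
  funext j
  fin_cases j <;> simp [quadForm, quadMap]

/-- The height of the image of a point differs from twice its height by a bounded amount. -/
theorem exists_abs_logHeight_quadMap_sub_le [AdmissibleAbsValues K] {l li : K}
    (h : l * li ≠ 1) :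
    ∃ C, ∀ p : Fin 2 → K, |logHeight (quadMap l li p) - 2 * logHeight p| ≤ C := by
  obtain ⟨C₁, h₁⟩ := logHeight_eval_le' (quadForm_isHomogeneous l li)
  obtain ⟨C₂, h₂⟩ := logHeight_eval_ge' (N := 2) (quadCofactor_isHomogeneous l li)
  have hR : 1 - l * li ≠ 0 := fun hh => h (sub_eq_zero.mp hh).symm
  have hR' : 1 - li * l ≠ 0 := by rwa [mul_comm]
  refine ⟨max C₁ (-C₂), fun p => abs_le.mpr ⟨?_, ?_⟩⟩
  · have := h₂ (quadForm l li) (x := p) (fun k => by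
      fin_cases k
      · simp [quadForm, quadCofactor]
        field_simp
        ring
      · simp [quadForm, quadCofactor]
        field_simp
        ring)
    rw [eval_quadForm] at this
    push_cast at this
    linarith [le_max_right C₁ (-C₂)]
  · have := h₁ p
    rw [eval_quadForm] at this
    push_cast at this
    linarith [le_max_left C₁ (-C₂)]

end Forms

section Points

variable {F : Type*} [Field F] [CharZero F]

theorem absLogHeight₁_zero : absLogHeight₁ (0 : F) = 0 := by
  have := absLogHeight₁_algebraMap (K := ℚ) (F := F) 0
  rwa [map_zero, logHeight₁_zero, zero_div] at this

theorem height_mk (p : Fin 2 → F) (hp : p ≠ 0) :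
    height (Projectivization.mk F p hp) = absLogHeight₁ (p 0 / p 1) := by
  obtain ⟨a, ha⟩ := Projectivization.exists_smul_eq_mk_rep F p hp
  have h : ∀ i, (Projectivization.mk F p hp).rep i = a * p i := fun i => by
    rw [← ha]; rfl
  have ha0 : (a : F) ≠ 0 := a.ne_zero
  rw [height, h, h, mul_div_mul_left _ _ ha0]
  split_ifs with h0
  · rw [(mul_eq_zero.mp h0).resolve_left ha0, div_zero, absLogHeight₁_zero]
  · rfl

end Points

section Orbits

variable {F : Type*} [Field F] {K : Type*} [Field K] [Algebra K F]

/-- Extension of scalars for homogeneous coordinates. -/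
def mapCoord (F : Type*) [Field F] [Algebra K F] (p : Fin 2 → K) : Fin 2 → F :=
  fun i => algebraMap K F (p i)

theorem quadMap_mapCoord (l li : K) (p : Fin 2 → K) :
    quadMap (algebraMap K F l) (algebraMap K F li) (mapCoord F p) =
      mapCoord F (quadMap l li p) := by
  funext i
  fin_cases i <;> simp [quadMap, mapCoord]

variable [IsAlgClosed F]

theorem quad_toFun_mk {l₀ linf : F} (h : l₀ * linf ≠ 1) (p : Fin 2 → F) (hp : p ≠ 0) :
    ∃ hq : quadMap l₀ linf p ≠ 0,
      (quad l₀ linf h).toFun (Projectivization.mk F p hp) =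
        Projectivization.mk F (quadMap l₀ linf p) hq := by
  have e : (fun i => MvPolynomial.eval p ((quad l₀ linf h).form i)) = quadMap l₀ linf p :=
    eval_quadForm l₀ linf p
  have hq : quadMap l₀ linf p ≠ 0 := e ▸ (quad l₀ linf h).no_common_zero p hp
  refine ⟨hq, ?_⟩
  simp only [Endo.toFun, Projectivization.lift_mk]
  congr 1

theorem quad_iterate_mk {l li : K} (h : algebraMap K F l * algebraMap K F li ≠ 1)
    (p : Fin 2 → K) (hp : mapCoord F p ≠ 0) (n : ℕ) :
    ∃ hq : mapCoord F ((quadMap l li)^[n] p) ≠ 0,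
      (quad (algebraMap K F l) (algebraMap K F li) h).toFun^[n]
        (Projectivization.mk F (mapCoord F p) hp) =
        Projectivization.mk F (mapCoord F ((quadMap l li)^[n] p)) hq := by
  induction n with
  | zero => exact ⟨hp, rfl⟩
  | succ n ih =>
    obtain ⟨hq, e⟩ := ih
    obtain ⟨hq', e'⟩ := quad_toFun_mk h _ hq
    simp only [quadMap_mapCoord] at hq' e'
    simp only [Function.iterate_succ_apply']
    exact ⟨hq', by rw [e, e']⟩

variable [CharZero F]

theorem height_iterate [NumberField K] {l li : K}
    (h : algebraMap K F l * algebraMap K F li ≠ 1) (p : Fin 2 → K) (hp : mapCoord F p ≠ 0)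
    (n : ℕ) :
    height ((quad (algebraMap K F l) (algebraMap K F li) h).toFun^[n]
      (Projectivization.mk F (mapCoord F p) hp)) =
      logHeight ((quadMap l li)^[n] p) / Module.finrank ℚ K := by
  obtain ⟨hq, e⟩ := quad_iterate_mk h p hp n
  rw [e, height_mk, mapCoord, mapCoord, ← map_div₀, absLogHeight₁_algebraMap,
    logHeight₁_div_eq_logHeight]
  congr 2
  funext i
  fin_cases i <;> rfl

/-- The canonical height exists at every point defined over a number field. -/
theorem tendsto_heightSeq [NumberField K] {l li : K}
    (h : algebraMap K F l * algebraMap K F li ≠ 1) (p : Fin 2 → K) (hp : mapCoord F p ≠ 0) :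
    Filter.Tendsto ((quad (algebraMap K F l) (algebraMap K F li) h).heightSeq
      (Projectivization.mk F (mapCoord F p) hp)) Filter.atTop
      (nhds ((quad (algebraMap K F l) (algebraMap K F li) h).canonicalHeight
        (Projectivization.mk F (mapCoord F p) hp))) := by
  have hK : l * li ≠ 1 := fun hh => h (by rw [← map_mul, hh, map_one])
  obtain ⟨C, hC⟩ := exists_abs_logHeight_quadMap_sub_le hK
  refine tendsto_nhds_limUnder (cauchySeq_tendsto_of_complete ?_)
  have hd : (0 : ℝ) < Module.finrank ℚ K := by exact_mod_cast Module.finrank_pos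
  refine cauchySeq_of_le_geometric (1 / 2) (C / (2 * Module.finrank ℚ K)) (by norm_num)
    fun n => ?_
  rw [dist_comm, Real.dist_eq, Endo.heightSeq, Endo.heightSeq, height_iterate, height_iterate,
    Function.iterate_succ_apply']
  set q := (quadMap l li)^[n] p
  have e : logHeight (quadMap l li q) / Module.finrank ℚ K / ((2 : ℕ) : ℝ) ^ (n + 1) -
      logHeight q / Module.finrank ℚ K / ((2 : ℕ) : ℝ) ^ n =
      (logHeight (quadMap l li q) - 2 * logHeight q) / (2 * Module.finrank ℚ K) *
        (1 / 2) ^ n := by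
    push_cast
    rw [pow_succ, one_div, inv_pow]
    field_simp
  rw [e, abs_mul, abs_div, abs_of_pos (by positivity : (0 : ℝ) < 2 * Module.finrank ℚ K),
    abs_of_pos (by positivity : (0 : ℝ) < (1 / 2) ^ n)]
  gcongr
  exact hC q

end Orbits

section CriticalPoint

variable {K : Type*} [Field K] [CharZero K]

/-- From the first image on, the orbit of a critical point is `critOrbit`, up to scaling the
homogeneous coordinates. -/
theorem exists_quadMap_iterate_eq {l li x y : K} (hl : l ≠ 0) (hli : li ≠ 0) (hR : l * li ≠ 1)
    (hxy : x ≠ 0 ∨ y ≠ 0) (hcrit : li * x ^ 2 + 2 * x * y + l * y ^ 2 = 0) :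
    ∃ s : K, s ≠ 0 ∧ s ^ 2 = 1 - l * li ∧ ∀ n : ℕ, ∃ c : K, c ≠ 0 ∧
      (quadMap l li)^[n + 1] ![x, y] = c • ![l * (critOrbit l s n).1, (critOrbit l s n).2] := by
  have hy : y ≠ 0 := by
    rintro rfl
    have hx : x = 0 := by simpa [hli] using hcrit
    simp [hx] at hxy
  set s := li * (x / y) + 1 with hs
  have hs2 : s ^ 2 = 1 - l * li := by
    rw [hs]; field_simp; linear_combination li * hcrit
  have hs0 : s ≠ 0 := by
    intro h
    rw [h] at hs2
    exact hR (by linear_combination hs2)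
  have hσ : 1 + s ≠ 0 := by
    intro h
    have : s = -1 := by linear_combination h
    rw [this] at hs2
    exact mul_ne_zero hl hli (by linear_combination hs2)
  have hx : x = -l * y / (1 + s) := by
    rw [eq_div_iff hσ, hs]; field_simp; linear_combination hcrit
  have hli' : li = (1 - s ^ 2) / l := by
    rw [eq_div_iff hl]; linear_combination hs2
  have hfun : ∀ (c : K) (a b : K), quadMap l li (c • ![l * a, b]) =
      c ^ 2 • ![l * (step l s (a, b)).1, (step l s (a, b)).2] := by
    intro c a b
    funext i
    fin_cases i
    · simp [quadMap, step]; ring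
    · simp [quadMap, step, hli']; field_simp
  refine ⟨s, hs0, hs2, fun n => ?_⟩
  induction n with
  | zero =>
    refine ⟨y ^ 2 * s / (1 + s) ^ 2, by positivity, ?_⟩
    funext i
    fin_cases i
    · simp [quadMap, critOrbit, hx]; field_simp; ring
    · simp [quadMap, critOrbit, hx, hli']; field_simp; ring
  | succ n ih =>
    obtain ⟨c, hc, e⟩ := ih
    refine ⟨c ^ 2, pow_ne_zero 2 hc, ?_⟩
    rw [Function.iterate_succ_apply', e, hfun, critOrbit_succ]

end CriticalPoint

/-! ### The critical points -/

theorem isIntegral_algebraicClosure_rat (x : AlgebraicClosure ℚ) : IsIntegral ℚ x :=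
  ((AlgebraicClosure.isAlgebraic ℚ).isAlgebraic x).isIntegral

theorem absLogHeight₁_nonneg (x : AlgebraicClosure ℚ) : 0 ≤ absLogHeight₁ x := by
  have hx := isIntegral_algebraicClosure_rat x
  have : FiniteDimensional ℚ (IntermediateField.adjoin ℚ {x}) :=
    IntermediateField.adjoin.finiteDimensional hx
  have : NumberField (IntermediateField.adjoin ℚ {x}) := {}
  have h := absLogHeight₁_algebraMap (F := AlgebraicClosure ℚ)
    (IntermediateField.AdjoinSimple.gen ℚ x)
  rw [IntermediateField.AdjoinSimple.algebraMap_gen] at h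
  rw [h]
  positivity

theorem height_nonneg (P : P1 (AlgebraicClosure ℚ)) : 0 ≤ height P := by
  rw [height]
  split_ifs
  · exact le_rfl
  · exact absLogHeight₁_nonneg _

section Descent

variable {K : Type*} [Field K] [NumberField K] {F : Type*} [Field F] [CharZero F] [IsAlgClosed F]
  [Algebra K F]

/-- The lower bound, in terms of heights relative to a number field of definition. -/
theorem canonicalHeight_ge {l li x y : K} (hl : l ≠ 0) (hli : li ≠ 0)
    (h : algebraMap K F l * algebraMap K F li ≠ 1)
    (hp : mapCoord F ![x, y] ≠ 0) (hcrit : li * x ^ 2 + 2 * x * y + l * y ^ 2 = 0) :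
    (1 / 32 * logHeight₁ li - 25 / 32 * logHeight₁ l) / Module.finrank ℚ K -
        47 / 32 * Real.log 2 - 3 / 16 * Real.log 3 ≤
      (quad (algebraMap K F l) (algebraMap K F li) h).canonicalHeight
        (Projectivization.mk F (mapCoord F ![x, y]) hp) := by
  have hR : l * li ≠ 1 := fun hh => h (by rw [← map_mul, hh, map_one])
  have hxy : x ≠ 0 ∨ y ≠ 0 := by
    by_contra! hh
    exact hp (by funext i; fin_cases i <;> simp [mapCoord, hh.1, hh.2])
  obtain ⟨s, hs0, hs2, hs⟩ := exists_quadMap_iterate_eq hl hli hR hxy hcrit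
  obtain ⟨E, hE⟩ := logHeight₁_critOrbit_ge hl hs0
  have hd : (0 : ℝ) < Module.finrank ℚ K := by exact_mod_cast Module.finrank_pos
  rw [totalWeight_eq_finrank] at hE
  set d : ℝ := ((Module.finrank ℚ K : ℕ) : ℝ)
  set B : ℝ := 1 / 8 * logHeight₁ s - 3 / 2 * logHeight₁ l - d * archLoss
  -- the height of `l∞ = (1 - s ^ 2) / l₀` in terms of that of `s`
  have hli' : logHeight₁ li ≤ d * Real.log 2 + 2 * logHeight₁ s + logHeight₁ l := by
    have e : li = (1 - s ^ 2) * l⁻¹ := by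
      rw [eq_mul_inv_iff_mul_eq₀ hl]; linear_combination hs2
    have h1 := logHeight₁_mul_le (1 - s ^ 2) l⁻¹
    have h2 := logHeight₁_sub_le 1 (s ^ 2)
    rw [← e, logHeight₁_inv] at h1
    rw [logHeight₁_one, logHeight₁_pow, totalWeight_eq_finrank] at h2
    push_cast at h2
    linarith
  have hB : (1 / 32 * logHeight₁ li - 25 / 32 * logHeight₁ l) / d -
      47 / 32 * Real.log 2 - 3 / 16 * Real.log 3 ≤ B / (2 * d) := by
    have e : (1 / 32 * logHeight₁ li - 25 / 32 * logHeight₁ l) / d -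
        47 / 32 * Real.log 2 - 3 / 16 * Real.log 3 =
        (1 / 16 * logHeight₁ li - 25 / 16 * logHeight₁ l -
          47 / 16 * (d * Real.log 2) - 3 / 8 * (d * Real.log 3)) / (2 * d) := by
      field_simp
      ring
    rw [e]
    gcongr
    simp only [B, archLoss]
    linarith
  refine hB.trans ?_
  have hlim := (tendsto_heightSeq h ![x, y] hp).comp (Filter.tendsto_add_atTop_nat 1)
  have hlow : Filter.Tendsto (fun n : ℕ => B / (2 * d) - E / (2 * d) * (1 / 2) ^ n)
      Filter.atTop (nhds (B / (2 * d))) := by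
    have := (tendsto_pow_atTop_nhds_zero_of_lt_one (r := (1 / 2 : ℝ)) (by norm_num)
      (by norm_num)).const_mul (E / (2 * d))
    simpa using this.const_sub (B / (2 * d))
  refine le_of_tendsto_of_tendsto hlow hlim ?_
  filter_upwards [Filter.eventually_ge_atTop 2] with n hn
  obtain ⟨c, hc, e⟩ := hs n
  rw [Function.comp_apply, Endo.heightSeq, height_iterate, e, logHeight_smul_eq_logHeight _ hc,
    ← logHeight₁_div_eq_logHeight]
  have h1 := hE n hn
  have e1 : B / (2 * d) - E / (2 * d) * (1 / 2) ^ n = (2 ^ n * B - E) / d / 2 ^ (n + 1) := by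
    rw [pow_succ, one_div, inv_pow]
    field_simp
  rw [e1]
  push_cast
  gcongr

end Descent

/-- In characteristic zero, the critical points are the zeros of `l∞ x² + 2 x y + l₀ y²`. -/
theorem isCritical_quad_iff {F : Type*} [Field F] [IsAlgClosed F] [CharZero F] {l₀ linf : F}
    (h : l₀ * linf ≠ 1) (P : P1 F) :
    (quad l₀ linf h).IsCritical P ↔
      linf * P.rep 0 ^ 2 + 2 * P.rep 0 * P.rep 1 + l₀ * P.rep 1 ^ 2 = 0 := by
  have e : MvPolynomial.eval P.rep (quad l₀ linf h).jacobian =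
      2 * (linf * P.rep 0 ^ 2 + 2 * P.rep 0 * P.rep 1 + l₀ * P.rep 1 ^ 2) := by
    simp [Endo.jacobian, quad, Derivation.leibniz, MvPolynomial.pderiv_X]
    ring
  rw [Endo.IsCritical, e, mul_eq_zero, or_iff_right two_ne_zero]

end QuadraticMorphism

theorem mainTheorem5 (l₀ linf : AlgebraicClosure ℚ) (hl₀ : l₀ ≠ 0) (hdeg : l₀ * linf ≠ 1)
    (ζ : QuadraticMorphism.P1 (AlgebraicClosure ℚ))
    (hζ : (QuadraticMorphism.quad l₀ linf hdeg).IsCritical ζ) :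
    Filter.Tendsto ((QuadraticMorphism.quad l₀ linf hdeg).heightSeq ζ) Filter.atTop
        (nhds ((QuadraticMorphism.quad l₀ linf hdeg).canonicalHeight ζ)) ∧
      (1 / 32 : ℝ) * NumberField.absLogHeight₁ linf - (25 / 32 : ℝ) * NumberField.absLogHeight₁ l₀
          - (47 / 32 : ℝ) * Real.log 2 - (3 / 16 : ℝ) * Real.log 3
        ≤ (QuadraticMorphism.quad l₀ linf hdeg).canonicalHeight ζ := by
  -- a number field over which the map and the critical point are defined
  obtain ⟨K, hfin, h0, h1, h2, h3⟩ : ∃ K : IntermediateField ℚ (AlgebraicClosure ℚ),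
      FiniteDimensional ℚ K ∧ l₀ ∈ K ∧ linf ∈ K ∧ ζ.rep 0 ∈ K ∧ ζ.rep 1 ∈ K := by
    have hsub := IntermediateField.subset_adjoin ℚ
      ({l₀, linf, ζ.rep 0, ζ.rep 1} : Set (AlgebraicClosure ℚ))
    exact ⟨_, IntermediateField.finiteDimensional_adjoin fun x _ =>
      QuadraticMorphism.isIntegral_algebraicClosure_rat x,
      hsub (by simp), hsub (by simp), hsub (by simp), hsub (by simp)⟩
  have : NumberField K := {}
  have hcrit := (QuadraticMorphism.isCritical_quad_iff hdeg ζ).mp hζ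
  obtain ⟨l, rfl⟩ : ∃ l : K, algebraMap K _ l = l₀ := ⟨⟨l₀, h0⟩, rfl⟩
  obtain ⟨li, rfl⟩ : ∃ li : K, algebraMap K _ li = linf := ⟨⟨linf, h1⟩, rfl⟩
  obtain ⟨x, hx⟩ : ∃ x : K, algebraMap K _ x = ζ.rep 0 := ⟨⟨ζ.rep 0, h2⟩, rfl⟩
  obtain ⟨y, hy⟩ : ∃ y : K, algebraMap K _ y = ζ.rep 1 := ⟨⟨ζ.rep 1, h3⟩, rfl⟩
  have hrep : QuadraticMorphism.mapCoord (AlgebraicClosure ℚ) ![x, y] = ζ.rep := by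
    funext i
    fin_cases i
    · exact hx
    · exact hy
  have hp : QuadraticMorphism.mapCoord (AlgebraicClosure ℚ) ![x, y] ≠ 0 :=
    hrep ▸ ζ.rep_nonzero
  have hmk : ζ = Projectivization.mk _ _ hp := by
    rw [← ζ.mk_rep]
    congr 1
    exact hrep.symm
  have hlim := QuadraticMorphism.tendsto_heightSeq hdeg ![x, y] hp
  rw [← hmk] at hlim
  refine ⟨hlim, ?_⟩
  have hl : l ≠ 0 := fun h => hl₀ (by rw [h, map_zero])
  by_cases hli : li = 0
  · -- the map is a polynomial and the right-hand side is not positive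
    have hnn : 0 ≤ (QuadraticMorphism.quad _ _ hdeg).canonicalHeight ζ :=
      ge_of_tendsto' hlim fun n => div_nonneg (QuadraticMorphism.height_nonneg _) (by positivity)
    have e0 : NumberField.absLogHeight₁ (algebraMap K (AlgebraicClosure ℚ) li) = 0 := by
      rw [hli, map_zero, QuadraticMorphism.absLogHeight₁_zero]
    have e1 := QuadraticMorphism.absLogHeight₁_nonneg (algebraMap K (AlgebraicClosure ℚ) l)
    have e2 : 0 ≤ Real.log 2 := Real.log_nonneg one_le_two
    have e3 : 0 ≤ Real.log 3 := Real.log_nonneg (by norm_num)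
    rw [e0]
    linarith
  · have hcritK : li * x ^ 2 + 2 * x * y + l * y ^ 2 = 0 := by
      apply (algebraMap K (AlgebraicClosure ℚ)).injective
      rw [← hx, ← hy] at hcrit
      simpa only [map_add, map_mul, map_pow, map_ofNat, map_zero] using hcrit
    have := QuadraticMorphism.canonicalHeight_ge hl hli hdeg hp hcritK
    rw [← hmk] at this
    rw [QuadraticMorphism.absLogHeight₁_algebraMap, QuadraticMorphism.absLogHeight₁_algebraMap]
    refine le_trans (le_of_eq ?_) this
    ring
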